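/- Let $n\ge 1$ and let $\Omega\subset\mathbb R^n$ be a bounded domain (a nonempty, bounded, connected open set). If $n>1$, suppose that there exist $n$ points $x_1,\dots,x_n\in\partial\Omega$, in a neighbourhood of each of which $\partial\Omega$ is $C^1$ (that is, in a ball around $x_i$ and in suitable orthonormal coordinates, $\Omega$ is the region strictly below the graph of a $C^1$ function and $\partial\Omega$ is that graph), such that the corresponding unit outward normals $\nu_1,\dots,\nu_n$ span $\mathbb R^n$. Let $M^{n\times n}_+$ be the set of real $n\times n$ matrices with positive determinant, let $\Psi:M^{n\times n}_+\to\mathbb R$ be continuous, and for $M\in M^{n\times n}_+$ let $\mathcal A_M$ be the set of orientation-preserving diffeomorphisms $y$ of $\Omega$ onto $M\Omega=\{Mx:x\in\Omega\}$, that is, of $C^1$ bijections $y:\Omega\to M\Omega$ with $C^1$ inverse and $\det Dy>0$ in $\Omega$. Then $$\frac{1}{\mathcal L^n(\Omega)}\int_\Omega \Psi(Dy(x))\,dx\ \ge\ \Psi(M)\qquad\text{for all } M\in M^{n\times n}_+ \text{ and all } y\in\mathcal A_M$$ if and only if there is a convex function $h:(0,\infty)\to\mathbb R$ such that $$\Psi(A)=h(\det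 A)\qquad\text{for all } A\in M^{n\times n}_+.$$ Here $\mathcal L^n$ is Lebesgue measure, and the inequality means that the integral is well defined in $(-\infty,+\infty]$ (the negative part of $\Psi(Dy)$ is integrable) and that the inequality holds, the value $+\infty$ being allowed. -/

import Mathlib

open MeasureTheory Set
open scoped InnerProductSpace

noncomputable section

namespace BoundarySliding

/-- Euclidean space `ℝⁿ`. -/
abbrev E (n : ℕ) : Type := EuclideanSpace ℝ (Fin n)

/-- The set `M₊^{n×n}` of real `n × n` matrices with positive determinant. -/
def MatPos (n : ℕ) : Set (Matrix (Fin n) (Fin n) ℝ) := {A | 0 < A.det}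

/-- The image `M Ω = {M x : x ∈ Ω}` of a set under a matrix. -/
def matImage {n : ℕ} (M : Matrix (Fin n) (Fin n) ℝ) (Ω : Set (E n)) : Set (E n) :=
  (fun x : E n => WithLp.toLp 2 (M.mulVec (WithLp.ofLp x))) '' Ω

/-- The gradient (Jacobian matrix) `Dy(x)`, with entries `∂yᵢ/∂xⱼ (x)`. -/
def grad {n : ℕ} (y : E n → E n) (x : E n) : Matrix (Fin n) (Fin n) ℝ :=
  Matrix.of fun i j => (fderiv ℝ y x (EuclideanSpace.single j 1)) i

/-- `y` restricts to a `C¹` diffeomorphism of the (open) set `U` onto the (open) set `V`, with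
positive Jacobian determinant. The values of `y` outside `U` play no role. -/
structure IsOrientationPreservingDiffeo {n : ℕ} (U V : Set (E n)) (y : E n → E n) : Prop where
  contDiffOn : ContDiffOn ℝ 1 y U
  mapsTo : MapsTo y U V
  exists_inverse : ∃ g : E n → E n, ContDiffOn ℝ 1 g V ∧ MapsTo g V U ∧ InvOn g y U V
  det_pos : ∀ x ∈ U, 0 < (grad y x).det

/-- The class `𝒜_M` of orientation-preserving diffeomorphisms of `Ω` onto `M Ω`. -/
def admissible {n : ℕ} (Ω : Set (E n)) (M : Matrix (Fin n) (Fin n) ℝ) : Set (E n → E n) :=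
  {y | IsOrientationPreservingDiffeo Ω (matImage M Ω) y}

/-- In a ball around `x`, in an orthonormal coordinate system with vertical unit vector `e`, the
set `Ω` is the region strictly below the graph of the `C¹` function `f` of the horizontal
coordinates `z' ∈ e^⊥`, and its boundary is that graph. -/
structure IsC1SubgraphNear {n : ℕ} (Ω : Set (E n)) (x e : E n)
    (f : (Submodule.span ℝ {e})ᗮ → ℝ) : Prop where
  norm_eq_one : ‖e‖ = 1
  contDiff : ContDiff ℝ 1 f
  exists_ball : ∃ ε > 0,
    Ω ∩ Metric.ball x ε =
      {z ∈ Metric.ball x ε | ⟪e, z⟫_ℝ < f ((Submodule.span ℝ {e})ᗮ.orthogonalProjectionOnto z)} ∧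
    frontier Ω ∩ Metric.ball x ε =
      {z ∈ Metric.ball x ε | ⟪e, z⟫_ℝ = f ((Submodule.span ℝ {e})ᗮ.orthogonalProjectionOnto z)}

/-- `x` is a boundary point of `Ω`, the boundary is `C¹` in a neighbourhood of `x`, and `ν` is the
unit outward normal at `x`: if the boundary is the graph of `f` over `e^⊥` near `x = (x', f x')`,
with `Ω` below it, then `ν = (e - ∇f(x')) / |e - ∇f(x')|`. -/
def IsC1OutwardNormal {n : ℕ} (Ω : Set (E n)) (x ν : E n) : Prop :=
  x ∈ frontier Ω ∧
    ∃ (e : E n) (f : (Submodule.span ℝ {e})ᗮ → ℝ), IsC1SubgraphNear Ω x e f ∧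
      ∃ w : E n,
        w = e - ((gradient f ((Submodule.span ℝ {e})ᗮ.orthogonalProjectionOnto x) :
          (Submodule.span ℝ {e})ᗮ) : E n) ∧
        ν = ‖w‖⁻¹ • w

/-- The average `⨍_Ω f` of a real function as an extended real number: the average of the positive
part minus the average of the negative part. It is `+∞` if only the positive part has an infinite
integral, and `-∞` if the negative part has an infinite integral (in `EReal`, `⊤ - ⊤ = ⊥`), so that
`c ≤ extAverage Ω f` for a real `c` says that the negative part is integrable, hence that
the average is well defined in `(-∞, +∞]`, and that it is at least `c`. -/
def extAverage {n : ℕ} (Ω : Set (E n)) (f : E n → ℝ) : EReal :=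
  ((⨍⁻ x in Ω, ENNReal.ofReal (f x) ∂volume : ENNReal) : EReal) -
    ((⨍⁻ x in Ω, ENNReal.ofReal (-f x) ∂volume : ENNReal) : EReal)

end BoundarySliding

end

/-!
Testing minimality of the linear map `M` with `M ∘ φ`, where `φ` is a diffeomorphism of `Ω` onto
itself which slides the domain along its boundary, shows that `Ψ` depends only on the determinant.
Near a `C¹` boundary point, blow up by `r` in the tangential directions and by `r ^ 2` in the
normal direction: the boundary is straightened to that of a half-ball, and the slide
`z ↦ z + bump z • r • τ` with `τ` horizontal is compatible with it. As `r → 0` its derivatives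
tend to the shears `1 + l p(z) σ ⊗ ν` along the tangent hyperplane, where `σ ⊥ ν` and the function
`p`, the normal derivative of the bump, is positive on the half-ball. With `g` the restriction of
`Ψ` to the line of matrices `M (1 + s σ ⊗ ν)`, minimality becomes `∫ (g (a + l p) - g a) ≥ 0` for
all `a` and all `l` of either sign, which forces the continuous function `g` to be constant. When
the normals `ν` span, the shears along their tangent hyperplanes generate `SL(n)`.

Testing with `x ↦ x + bump x • v` on small balls, where the determinant takes values on both sides
of `1` with mean `1`, then shows that `h` is convex: otherwise `h` minus a suitable affine function
has a maximum which violates the resulting inequality. Conversely, if `Ψ = h ∘ det` with `h`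
convex, the inequality is Jensen's, since the mean of `det Dy` over `Ω` is `det M`.
-/

noncomputable section

namespace BoundarySliding

open Filter Topology

section RealAnalysis

theorem exists_last_max {k : ℝ → ℝ} {a b m : ℝ} (hk : ContinuousOn k (Icc a b))
    (hm : m ∈ Icc a b) (hb : k b < k m) :
    ∃ d ∈ Ico a b, (∀ t ∈ Icc a b, k t ≤ k d) ∧ ∀ t ∈ Icc a b, d < t → k t < k d := by
  obtain ⟨s, hs, hmax⟩ := isCompact_Icc.exists_isMaxOn ⟨m, hm⟩ hk
  have hcompact : IsCompact (Icc a b ∩ k ⁻¹' {k s}) :=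
    isCompact_Icc.of_isClosed_subset
      (hk.preimage_isClosed_of_isClosed isClosed_Icc isClosed_singleton) inter_subset_left
  obtain ⟨d, ⟨hd, hds : k d = k s⟩, hlast⟩ := hcompact.exists_isGreatest ⟨s, hs, rfl⟩
  have hle : ∀ t ∈ Icc a b, k t ≤ k d := fun t ht => hds ▸ hmax ht
  refine ⟨d, ⟨hd.1, hd.2.lt_of_ne ?_⟩, hle, fun t ht hdt => (hle t ht).lt_of_ne fun h => ?_⟩
  · rintro rfl
    exact (hb.trans_le (hle m hm)).false
  · exact hdt.not_ge (hlast ⟨ht, h.trans hds⟩)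

theorem setIntegral_sub_chord {X : Type*} [MeasurableSpace X] {μ : Measure X} {U : Set X}
    (hμ : μ U ≠ ⊤) {f q : X → ℝ} (hf : IntegrableOn f U μ) (hq : IntegrableOn q U μ)
    (hq0 : ∫ x in U, q x ∂μ = 0) (c d t y : ℝ) :
    ∫ x in U, (f x - c * (d + t * q x) - (y - c * d)) ∂μ = ∫ x in U, (f x - y) ∂μ := by
  have hfy : IntegrableOn (fun x => f x - y) U μ := hf.sub (integrableOn_const hμ)
  calc ∫ x in U, (f x - c * (d + t * q x) - (y - c * d)) ∂μ
      = ∫ x in U, ((f x - y) - c * t * q x) ∂μ := by congr with x; ring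
    _ = ∫ x in U, (f x - y) ∂μ := by
        rw [integral_sub hfy (hq.const_mul _), integral_const_mul, hq0, mul_zero, sub_zero]

variable {X : Type*} [TopologicalSpace X] [MeasurableSpace X] [OpensMeasurableSpace X]
  {μ : Measure X} {U : Set X}

theorem continuousOn_setIntegral_of_continuousOn_prod {Y : Type*} [TopologicalSpace Y]
    [FirstCountableTopology Y] [IsFiniteMeasureOnCompacts μ] {S : Set Y} {K : Set X}
    (hS : IsCompact S) (hK : IsCompact K) (hU : MeasurableSet U) (hUK : U ⊆ K) {f : Y → X → ℝ}
    (hf : ContinuousOn (Function.uncurry f) (S ×ˢ K)) :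
    ContinuousOn (fun s => ∫ x in U, f s x ∂μ) S := by
  obtain ⟨C, hC⟩ := (hS.prod hK).exists_bound_of_continuousOn hf
  intro s₀ hs₀
  refine tendsto_integral_filter_of_dominated_convergence (fun _ => C) ?_ ?_ ?_ ?_
  · filter_upwards [self_mem_nhdsWithin] with s hs
    have hfs : ContinuousOn (f s) U :=
      hf.comp (f := fun x => (s, x)) (by fun_prop) fun x hx => ⟨hs, hUK hx⟩
    exact hfs.aestronglyMeasurable hU
  · filter_upwards [self_mem_nhdsWithin] with s hs
    filter_upwards [ae_restrict_mem hU] with x hx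
    exact hC (s, x) ⟨hs, hUK hx⟩
  · exact integrableOn_const (measure_ne_top_of_subset hUK hK.measure_lt_top.ne)
  · filter_upwards [ae_restrict_mem hU] with x hx
    have hfx : ContinuousOn (fun s => f s x) S :=
      hf.comp (f := fun s => (s, x)) (by fun_prop) fun s hs => ⟨hs, hUK hx⟩
    exact hfx s₀ hs₀

theorem integrableOn_comp_of_mapsTo_isCompact (hU : IsOpen U) (hμ : μ U ≠ ⊤) {Y : Type*}
    [TopologicalSpace Y] {K : Set Y} (hK : IsCompact K) {k : Y → ℝ} (hk : ContinuousOn k K)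
    {q : X → Y} (hq : ContinuousOn q U) (hqK : MapsTo q U K) :
    IntegrableOn (fun x => k (q x)) U μ := by
  obtain ⟨C, hC⟩ := hK.exists_bound_of_continuousOn hk
  refine IntegrableOn.of_bound hμ.lt_top
    ((hk.comp hq hqK).aestronglyMeasurable hU.measurableSet) C ?_
  filter_upwards [ae_restrict_mem hU.measurableSet] with x hx
  exact hC _ (hqK hx)

variable [μ.IsOpenPosMeasure]

theorem setIntegral_neg_of_nonpos (hU : IsOpen U) {f : X → ℝ} (hf : ContinuousOn f U)
    (hi : IntegrableOn f U μ) (hle : ∀ x ∈ U, f x ≤ 0) {z : X} (hz : z ∈ U) (hfz : f z < 0) :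
    ∫ x in U, f x ∂μ < 0 := by
  rw [← neg_pos, ← integral_neg]
  refine (setIntegral_pos_iff_support_of_nonneg_ae ?_ hi.neg).2 ?_
  · filter_upwards [ae_restrict_mem hU.measurableSet] with x hx
    exact neg_nonneg.2 (hle x hx)
  · refine ((hf.isOpen_inter_preimage hU isOpen_Iio).measure_pos μ ⟨z, hz, hfz⟩).trans_le
      (measure_mono ?_)
    rintro x ⟨hx, hfx : f x < 0⟩
    exact ⟨(neg_pos.2 hfx).ne', hx⟩

theorem setIntegral_comp_sub_neg_of_last_max (hU : IsOpen U) (hμ : μ U ≠ ⊤) {k : ℝ → ℝ}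
    {a b d : ℝ} (hk : ContinuousOn k (Icc a b)) (hmax : ∀ t ∈ Icc a b, k t ≤ k d)
    (hlast : ∀ t ∈ Icc a b, d < t → k t < k d) {q : X → ℝ} (hq : ContinuousOn q U)
    (hqI : MapsTo q U (Icc a b)) {z : X} (hz : z ∈ U) (hqz : d < q z) :
    ∫ x in U, (k (q x) - k d) ∂μ < 0 := by
  have hk' : ContinuousOn (fun t => k t - k d) (Icc a b) := hk.sub continuousOn_const
  exact setIntegral_neg_of_nonpos hU (hk'.comp hq hqI)
    (integrableOn_comp_of_mapsTo_isCompact hU hμ isCompact_Icc hk' hq hqI)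
    (fun x hx => sub_nonpos.2 (hmax _ (hqI hx))) hz (sub_neg.2 (hlast _ (hqI hz) hqz))

theorem monotone_of_forall_setIntegral_nonneg (hU : IsOpen U) (hμ : μ U ≠ ⊤) {p : X → ℝ} {P : ℝ}
    (hp : ContinuousOn p U) (hpP : MapsTo p U (Icc 0 P)) {z : X} (hz : z ∈ U) (hpz : 0 < p z)
    {g : ℝ → ℝ} (hg : Continuous g)
    (h : ∀ a l : ℝ, 0 ≤ ∫ x in U, (g (a + l * p x) - g a) ∂μ) : Monotone g := by
  intro a b hab
  by_contra! hlt
  obtain ⟨d, hd, hmax, hlast⟩ := exists_last_max hg.continuousOn (left_mem_Icc.2 hab) hlt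
  have hP : 0 < P := hpz.trans_le (hpP hz).2
  have hl : 0 < (b - d) / P := div_pos (sub_pos.2 hd.2) hP
  refine (h d ((b - d) / P)).not_gt
    (setIntegral_comp_sub_neg_of_last_max hU hμ hg.continuousOn hmax hlast (by fun_prop) ?_ hz ?_)
  · intro x hx
    have hle : (b - d) / P * p x ≤ b - d := by
      rw [div_mul_eq_mul_div, div_le_iff₀ hP]
      exact mul_le_mul_of_nonneg_left (hpP hx).2 (sub_pos.2 hd.2).le
    exact ⟨by nlinarith [hd.1, (hpP hx).1], by linarith⟩
  · exact lt_add_of_pos_right d (mul_pos hl hpz)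

theorem eq_of_forall_setIntegral_nonneg (hU : IsOpen U) (hμ : μ U ≠ ⊤) {p : X → ℝ} {P : ℝ}
    (hp : ContinuousOn p U) (hpP : MapsTo p U (Icc 0 P)) {z : X} (hz : z ∈ U) (hpz : 0 < p z)
    {g : ℝ → ℝ} (hg : Continuous g)
    (h : ∀ a l : ℝ, 0 ≤ ∫ x in U, (g (a + l * p x) - g a) ∂μ) (a b : ℝ) : g a = g b := by
  have hmono : Monotone g := monotone_of_forall_setIntegral_nonneg hU hμ hp hpP hz hpz hg h
  have hmono_neg : Monotone fun t => g (-t) :=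
    monotone_of_forall_setIntegral_nonneg hU hμ hp hpP hz hpz (by fun_prop) fun a l => by
      simpa only [neg_add, neg_mul] using h (-a) (-l)
  have hanti : Antitone g := fun s t hst => by simpa using hmono_neg (neg_le_neg hst)
  rcases le_total a b with hab | hab
  · exact (hmono hab).antisymm (hanti hab)
  · exact (hanti hab).antisymm (hmono hab)

theorem exists_last_max_sub_chord {s : Set ℝ} {h : ℝ → ℝ} (hh : ContinuousOn h s)
    (hs : Convex ℝ s) (hconv : ¬ ConvexOn ℝ s h) :
    ∃ a ∈ s, ∃ b ∈ s, ∃ c, ∃ d ∈ Ioo a b,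
      (∀ t ∈ Icc a b, h t - c * t ≤ h d - c * d) ∧
      ∀ t ∈ Icc a b, d < t → h t - c * t < h d - c * d := by
  contrapose! hconv
  refine LinearOrder.convexOn_of_lt hs fun x hx y hy hxy α β hα hβ hαβ => ?_
  by_contra! hlt
  obtain ⟨c, hc⟩ : ∃ c, c * (y - x) = h y - h x :=
    ⟨(h y - h x) / (y - x), div_mul_cancel₀ _ (sub_pos.2 hxy).ne'⟩
  set m := α • x + β • y with hm
  simp only [smul_eq_mul] at hm hlt
  obtain rfl : α = 1 - β := by linarith
  have hmI : m ∈ Icc x y := ⟨by rw [hm]; nlinarith, by rw [hm]; nlinarith⟩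
  have hkx : h x - c * x < h m - c * m := by
    have : c * m = c * x + β * (h y - h x) := by rw [← hc, hm]; ring
    linarith
  have hky : h y - c * y = h x - c * x := by linarith
  obtain ⟨d, hd, hmax, hlast⟩ := exists_last_max (k := fun t => h t - c * t)
    ((hh.mono (hs.ordConnected.out hx hy)).sub (by fun_prop)) hmI (hky ▸ hkx)
  have hxd : x < d := hd.1.lt_of_ne (by rintro rfl; exact (hkx.trans_le (hmax m hmI)).false)
  obtain ⟨t, ht, hdt, hle⟩ := hconv x hx y hy c d ⟨hxd, hd.2⟩ hmax
  exact hle.not_gt (hlast t ht hdt)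

theorem convexOn_of_eventually_setIntegral_nonneg (hU : IsOpen U) (hμ : μ U ≠ ⊤) {q : X → ℝ}
    {C : ℝ} (hq : ContinuousOn q U) (hqC : ∀ x ∈ U, |q x| ≤ C) (hq0 : ∫ x in U, q x ∂μ = 0)
    {z : X} (hz : z ∈ U) (hqz : 0 < q z) {s : Set ℝ} (hs : Convex ℝ s) {h : ℝ → ℝ}
    (hh : ContinuousOn h s)
    (hint : ∀ d ∈ s, ∀ᶠ t in 𝓝[>] (0 : ℝ), 0 ≤ ∫ x in U, (h (d + t * q x) - h d) ∂μ) :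
    ConvexOn ℝ s h := by
  by_contra hconv
  obtain ⟨a, ha, b, hb, c, d, hd, hmax, hlast⟩ := exists_last_max_sub_chord hh hs hconv
  have hsub : Icc a b ⊆ s := hs.ordConnected.out ha hb
  have hsmall : ∀ᶠ t in 𝓝[>] (0 : ℝ), d - t * C ∈ Ioo a b ∧ d + t * C ∈ Ioo a b := by
    refine (Filter.Tendsto.eventually_mem ?_ (Ioo_mem_nhds hd.1 hd.2)).and
      (Filter.Tendsto.eventually_mem ?_ (Ioo_mem_nhds hd.1 hd.2)) <;>
    exact (Continuous.tendsto' (by fun_prop) _ _ (by simp)).mono_left nhdsWithin_le_nhds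
  obtain ⟨t, ht, ⟨h₁, h₂⟩, ht0⟩ := ((hint d (hsub ⟨hd.1.le, hd.2.le⟩)).and
    (hsmall.and self_mem_nhdsWithin)).exists
  have hI : MapsTo (fun x => d + t * q x) U (Icc a b) := fun x hx => by
    have hqx := abs_le.1 (hqC x hx)
    constructor <;> nlinarith [h₁.1, h₂.2, le_of_lt (show 0 < t from ht0)]
  have hneg := setIntegral_comp_sub_neg_of_last_max hU hμ (k := fun t => h t - c * t)
    ((hh.mono hsub).sub (by fun_prop)) hmax hlast (by fun_prop) hI hz
    (lt_add_of_pos_right d (mul_pos ht0 hqz))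
  have hi : IntegrableOn (fun x => h (d + t * q x)) U μ :=
    integrableOn_comp_of_mapsTo_isCompact hU hμ isCompact_Icc (hh.mono hsub) (by fun_prop) hI
  have hqi : IntegrableOn q U μ :=
    IntegrableOn.of_bound hμ.lt_top (hq.aestronglyMeasurable hU.measurableSet) C <| by
      filter_upwards [ae_restrict_mem hU.measurableSet] with x hx using hqC x hx
  rw [setIntegral_sub_chord hμ hi hqi hq0] at hneg
  exact ht.not_gt hneg

end RealAnalysis

section Determinant

variable {V : Type*} [NormedAddCommGroup V] [NormedSpace ℝ V]

theorem det_mul (A B : V →L[ℝ] V) : (A * B).det = A.det * B.det :=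
  LinearMap.det_comp (A : V →ₗ[ℝ] V) (B : V →ₗ[ℝ] V)

theorem det_one_add_smulRight [FiniteDimensional ℝ V] (m : V →L[ℝ] ℝ) (v : V) :
    (1 + m.smulRight v : V →L[ℝ] V).det = 1 + m v :=
  LinearMap.transvection.det (m : V →ₗ[ℝ] ℝ) v

theorem det_one_sub_smulRight [FiniteDimensional ℝ V] (m : V →L[ℝ] ℝ) (v : V) :
    (1 - m.smulRight v : V →L[ℝ] V).det = 1 - m v := by
  have hneg : 1 - m.smulRight v = 1 + (-m).smulRight v := by ext; simp [sub_eq_add_neg]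
  rw [hneg, det_one_add_smulRight, neg_apply, sub_eq_add_neg]

end Determinant

section Bump

theorem hasDerivAt_max_zero_sq (t : ℝ) :
    HasDerivAt (fun s : ℝ => (max 0 s) ^ 2) (2 * max 0 t) t := by
  have hf : Continuous fun s : ℝ => (max 0 s) ^ 2 := by fun_prop
  have hf' : Continuous fun s : ℝ => 2 * max 0 s := by fun_prop
  refine hasDerivAt_of_hasDerivAt_of_ne' (x := 0) (fun s hs => ?_) hf.continuousAt
    hf'.continuousAt t
  rcases hs.lt_or_gt with h | h
  · rw [max_eq_left h.le, mul_zero]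
    refine (hasDerivAt_const s (0 : ℝ)).congr_of_eventuallyEq ?_
    filter_upwards [eventually_lt_nhds h] with u hu
    simp [max_eq_left hu.le]
  · rw [max_eq_right h.le]
    refine HasDerivAt.congr_of_eventuallyEq (by simpa using hasDerivAt_pow 2 s) ?_
    filter_upwards [eventually_gt_nhds h] with u hu
    rw [max_eq_right hu.le]

variable {V : Type*} [NormedAddCommGroup V]

/-- A nonnegative radial `C¹` bump function, positive exactly on the open unit ball. -/
def bump (z : V) : ℝ := (max 0 (1 - ‖z‖ ^ 2)) ^ 2

theorem max_zero_one_sub_norm_sq_of_one_le {z : V} (hz : 1 ≤ ‖z‖) : max 0 (1 - ‖z‖ ^ 2) = 0 :=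
  max_eq_left (by nlinarith)

theorem continuous_bump : Continuous (bump : V → ℝ) := by
  unfold bump
  fun_prop

theorem bump_of_one_le_norm {z : V} (hz : 1 ≤ ‖z‖) : bump z = 0 := by
  simp [bump, max_zero_one_sub_norm_sq_of_one_le hz]

variable [InnerProductSpace ℝ V]

/-- The derivative of `bump` at `z`. -/
def bumpDeriv (z : V) : V →L[ℝ] ℝ := (-4 * max 0 (1 - ‖z‖ ^ 2)) • innerSL ℝ z

theorem bumpDeriv_apply (z v : V) :
    bumpDeriv z v = -4 * max 0 (1 - ‖z‖ ^ 2) * ⟪z, v⟫_ℝ := by simp [bumpDeriv]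

theorem hasFDerivAt_bump (z : V) : HasFDerivAt bump (bumpDeriv z) z := by
  have hnorm : HasFDerivAt (fun z : V => 1 - ‖z‖ ^ 2) (-(2 • innerSL ℝ z)) z := by
    simpa using ((hasStrictFDerivAt_norm_sq z).hasFDerivAt).const_sub 1
  refine ((hasDerivAt_max_zero_sq (1 - ‖z‖ ^ 2)).comp_hasFDerivAt z hnorm).congr_fderiv ?_
  ext v
  simp only [smul_apply, neg_apply, innerSL_apply_apply, smul_eq_mul, nsmul_eq_mul,
    Nat.cast_ofNat, bumpDeriv_apply]
  ring

theorem continuous_bumpDeriv : Continuous (bumpDeriv : V → V →L[ℝ] ℝ) := by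
  unfold bumpDeriv
  fun_prop

theorem contDiff_bump : ContDiff ℝ 1 (bump : V → ℝ) :=
  contDiff_one_iff_hasFDerivAt.2 ⟨bumpDeriv, continuous_bumpDeriv, hasFDerivAt_bump⟩

theorem bumpDeriv_neg (z : V) : bumpDeriv (-z) = -bumpDeriv z := by
  simp [bumpDeriv]

theorem bumpDeriv_of_one_le_norm {z : V} (hz : 1 ≤ ‖z‖) : bumpDeriv z = 0 := by
  simp [bumpDeriv, max_zero_one_sub_norm_sq_of_one_le hz]

theorem norm_bumpDeriv_le (z : V) : ‖bumpDeriv z‖ ≤ 4 := by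
  rcases le_total 1 ‖z‖ with hz | hz
  · simp [bumpDeriv_of_one_le_norm hz]
  · have hmax : max 0 (1 - ‖z‖ ^ 2) ≤ 1 := max_le zero_le_one (by nlinarith [sq_nonneg ‖z‖])
    calc ‖bumpDeriv z‖ = 4 * max 0 (1 - ‖z‖ ^ 2) * ‖z‖ := by
          rw [bumpDeriv, norm_smul, norm_mul, innerSL_apply_norm, norm_neg,
            Real.norm_of_nonneg (le_max_left _ _), RCLike.norm_ofNat]
      _ ≤ 4 * 1 * 1 := by gcongr
      _ = 4 := by norm_num

theorem abs_bumpDeriv_apply_le (z v : V) : |bumpDeriv z v| ≤ 4 * ‖v‖ :=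
  (bumpDeriv z).le_of_opNorm_le (norm_bumpDeriv_le z) v

theorem one_add_bumpDeriv_apply_pos {v : V} (hv : ‖v‖ ≤ 1 / 8) (z : V) :
    0 < 1 + bumpDeriv z v := by
  linarith [(abs_le.1 (abs_bumpDeriv_apply_le z v)).1]

theorem bumpDeriv_apply_nonneg {z e : V} (h : ⟪e, z⟫_ℝ ≤ 0) : 0 ≤ bumpDeriv z e := by
  rw [bumpDeriv_apply, real_inner_comm]
  nlinarith [mul_nonneg (le_max_left 0 (1 - ‖z‖ ^ 2)) (neg_nonneg.2 h)]

theorem bumpDeriv_neg_half_smul_apply_pos {e : V} (he : ‖e‖ = 1) :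
    0 < bumpDeriv ((-(1 / 2 : ℝ)) • e) e := by
  rw [bumpDeriv_apply, norm_smul, real_inner_smul_left, real_inner_self_eq_norm_sq, he]
  norm_num

theorem setIntegral_ball_bumpDeriv_apply [MeasurableSpace V] [BorelSpace V] (μ : Measure V)
    [μ.IsNegInvariant] (e : V) : ∫ z in Metric.ball 0 1, bumpDeriv z e ∂μ = 0 := by
  have hodd := (Measure.measurePreserving_neg μ).setIntegral_preimage_emb
    (MeasurableEquiv.neg V).measurableEmbedding (fun z => bumpDeriv z e) (Metric.ball 0 1)
  have hball : Neg.neg ⁻¹' Metric.ball (0 : V) 1 = Metric.ball 0 1 := by ext; simp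
  simp only [hball, bumpDeriv_neg, neg_apply, integral_neg] at hodd
  linarith

end Bump

section Diffeo

open scoped Manifold

/-- The global `C¹` diffeomorphisms of a normed space `V`. -/
abbrev C1Diffeo (V : Type*) [NormedAddCommGroup V] [NormedSpace ℝ V] : Type _ :=
  V ≃ₘ^1⟮𝓘(ℝ, V), 𝓘(ℝ, V)⟯ V

variable {V : Type*} [NormedAddCommGroup V] [NormedSpace ℝ V]

theorem C1Diffeo.hasFDerivAt (φ : C1Diffeo V) (x : V) : HasFDerivAt φ (fderiv ℝ φ x) x :=
  (φ.contDiff.differentiable one_ne_zero x).hasFDerivAt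

theorem C1Diffeo.fderiv_symm_mul_fderiv (φ : C1Diffeo V) (x : V) :
    fderiv ℝ φ.symm (φ x) * fderiv ℝ φ x = 1 := by
  have h := (C1Diffeo.hasFDerivAt φ.symm (φ x)).comp x (C1Diffeo.hasFDerivAt φ x)
  rw [show φ.symm ∘ φ = id from funext φ.symm_apply_apply] at h
  exact h.unique (hasFDerivAt_id x)

theorem C1Diffeo.fderiv_mul_fderiv_symm (φ : C1Diffeo V) (x : V) :
    fderiv ℝ φ x * fderiv ℝ φ.symm (φ x) = 1 := by
  have h := C1Diffeo.fderiv_symm_mul_fderiv φ.symm (φ x)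
  rwa [φ.symm_apply_apply] at h

theorem approximatesLinearOn_id_add {u : V → V} (hu : ContDiff ℝ 1 u)
    (hb : ∀ x, ‖fderiv ℝ u x‖ ≤ 1 / 2) :
    ApproximatesLinearOn (fun x => x + u x)
      ((ContinuousLinearEquiv.refl ℝ V : V ≃L[ℝ] V) : V →L[ℝ] V) univ (1 / 2 : NNReal) := by
  have hlip : LipschitzWith (1 / 2 : NNReal) u :=
    lipschitzWith_of_nnnorm_fderiv_le (hu.differentiable one_ne_zero) fun x => by
      rw [← NNReal.coe_le_coe]
      simpa using hb x
  intro x _ y _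
  simpa [add_sub_add_comm] using hlip.norm_sub_le x y

theorem subsingleton_or_half_lt_nnnorm_refl_symm_inv (V : Type*) [NormedAddCommGroup V]
    [NormedSpace ℝ V] : Subsingleton V ∨ (1 / 2 : NNReal) <
      ‖((ContinuousLinearEquiv.refl ℝ V : V ≃L[ℝ] V).symm : V →L[ℝ] V)‖₊⁻¹ := by
  refine (subsingleton_or_nontrivial V).imp_right fun hV : Nontrivial V => ?_
  rw [ContinuousLinearEquiv.refl_symm, ContinuousLinearEquiv.coe_refl,
    ContinuousLinearMap.nnnorm_id, inv_one]
  exact NNReal.half_lt_self one_ne_zero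

variable [CompleteSpace V]

theorem contDiff_symm_of_eq_id_add {u : V → V} (hu : ContDiff ℝ 1 u)
    (hb : ∀ x, ‖fderiv ℝ u x‖ ≤ 1 / 2) (φ : V ≃ₜ V) (hφ : ⇑φ = fun x => x + u x) :
    ContDiff ℝ 1 φ.symm := by
  have hlt (x : V) : ‖-fderiv ℝ u x‖ < 1 := by
    rw [norm_neg]
    exact (hb x).trans_lt (by norm_num)
  refine φ.contDiff_symm (f₀' := fun x => ContinuousLinearEquiv.ofUnit
    (Units.oneSub (-fderiv ℝ u x) (hlt x))) (fun x => ?_) (hφ ▸ contDiff_id.add hu)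
  rw [hφ]
  refine ((hasFDerivAt_id x).add
    (hu.differentiable one_ne_zero x).hasFDerivAt).congr_fderiv ?_
  ext v
  simp [ContinuousLinearEquiv.ofUnit]

/-- The diffeomorphism `x ↦ x + u x`, where `u` is a `C¹` map with small derivative. -/
def idAddDiffeo (u : V → V) (hu : ContDiff ℝ 1 u) (hb : ∀ x, ‖fderiv ℝ u x‖ ≤ 1 / 2) :
    C1Diffeo V :=
  let φ : V ≃ₜ V := (approximatesLinearOn_id_add hu hb).toHomeomorph _
    (subsingleton_or_half_lt_nnnorm_refl_symm_inv V)
  { φ.toEquiv with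
    contMDiff_toFun := (contDiff_id.add hu).contMDiff
    contMDiff_invFun := (contDiff_symm_of_eq_id_add hu hb φ rfl).contMDiff }

end Diffeo

section BumpDiffeo

variable {V : Type*} [NormedAddCommGroup V] [InnerProductSpace ℝ V]

theorem hasFDerivAt_bump_smul (v z : V) :
    HasFDerivAt (fun z => bump z • v) ((bumpDeriv z).smulRight v) z :=
  (hasFDerivAt_bump z).smul_const v

variable [CompleteSpace V]

/-- The diffeomorphism `z ↦ z + bump z • v`, which is the identity off the unit ball. -/
def bumpDiffeo (v : V) (hv : ‖v‖ ≤ 1 / 8) : C1Diffeo V :=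
  idAddDiffeo (fun z => bump z • v) (contDiff_bump.smul contDiff_const) fun z => by
    rw [(hasFDerivAt_bump_smul v z).fderiv, ContinuousLinearMap.norm_smulRight_apply]
    calc ‖bumpDeriv z‖ * ‖v‖ ≤ 4 * (1 / 8) := by gcongr; exact norm_bumpDeriv_le z
      _ = 1 / 2 := by norm_num

variable {v : V} (hv : ‖v‖ ≤ 1 / 8)

theorem bumpDiffeo_apply (z : V) : bumpDiffeo v hv z = z + bump z • v := rfl

theorem fderiv_bumpDiffeo (z : V) :
    fderiv ℝ (bumpDiffeo v hv) z = 1 + (bumpDeriv z).smulRight v :=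
  ((hasFDerivAt_id z).add (hasFDerivAt_bump_smul v z)).fderiv

theorem bumpDiffeo_of_one_le_norm {z : V} (hz : 1 ≤ ‖z‖) : bumpDiffeo v hv z = z := by
  simp [bumpDiffeo_apply, bump_of_one_le_norm hz]

theorem fderiv_bumpDiffeo_of_one_le_norm {z : V} (hz : 1 ≤ ‖z‖) :
    fderiv ℝ (bumpDiffeo v hv) z = 1 := by
  simp [fderiv_bumpDiffeo, bumpDeriv_of_one_le_norm hz]

theorem hasCompactSupport_bumpDiffeo_sub [FiniteDimensional ℝ V] :
    HasCompactSupport fun z => bumpDiffeo v hv z - z := by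
  refine HasCompactSupport.intro (isCompact_closedBall 0 1) fun z hz => ?_
  rw [mem_closedBall_zero_iff, not_le] at hz
  rw [bumpDiffeo_of_one_le_norm hv hz.le, sub_self]

theorem norm_bumpDiffeo_lt_one_iff (z : V) : ‖bumpDiffeo v hv z‖ < 1 ↔ ‖z‖ < 1 := by
  refine ⟨fun h => ?_, fun h => ?_⟩ <;> by_contra! hz
  · rw [bumpDiffeo_of_one_le_norm hv hz] at h
    exact h.not_ge hz
  · have hfix : bumpDiffeo v hv z = z :=
      (bumpDiffeo v hv).injective (bumpDiffeo_of_one_le_norm hv hz)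
    exact h.not_ge (hfix ▸ hz)

theorem det_fderiv_bumpDiffeo_pos [FiniteDimensional ℝ V] (z : V) :
    0 < (fderiv ℝ (bumpDiffeo v hv) z).det := by
  rw [fderiv_bumpDiffeo, det_one_add_smulRight]
  exact one_add_bumpDeriv_apply_pos hv z

end BumpDiffeo

section Stability

variable {V : Type*} [NormedAddCommGroup V] [InnerProductSpace ℝ V]

/-- The derivative at `T z` of the conjugate `T ∘ ψ ∘ T⁻¹` of a diffeomorphism `ψ`. -/
def conjDeriv (T ψ : C1Diffeo V) (z : V) : V →L[ℝ] V :=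
  fderiv ℝ T (ψ z) * fderiv ℝ ψ z * fderiv ℝ T.symm (T z)

theorem fderiv_conj (T ψ : C1Diffeo V) (z : V) :
    fderiv ℝ (T.symm.trans (ψ.trans T)) (T z) = conjDeriv T ψ z := by
  have hψ : HasFDerivAt (ψ ∘ T.symm) (fderiv ℝ ψ z * fderiv ℝ T.symm (T z)) (T z) := by
    refine HasFDerivAt.comp (T z) ?_ (C1Diffeo.hasFDerivAt T.symm (T z))
    simpa using C1Diffeo.hasFDerivAt ψ z
  have hT : HasFDerivAt T (fderiv ℝ T (ψ z)) ((ψ ∘ T.symm) (T z)) := by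
    simpa using C1Diffeo.hasFDerivAt T (ψ z)
  rw [conjDeriv, mul_assoc]
  exact (hT.comp (T z) hψ).fderiv

theorem conjDeriv_eq_one {T ψ : C1Diffeo V} {z : V} (hz : ψ z = z) (hψ : fderiv ℝ ψ z = 1) :
    conjDeriv T ψ z = 1 := by
  rw [conjDeriv, hz, hψ, mul_one, C1Diffeo.fderiv_mul_fderiv_symm]

theorem det_conjDeriv {T ψ : C1Diffeo V} {δ : ℝ} (hT : ∀ z, (fderiv ℝ T z).det = δ) (z : V) :
    (conjDeriv T ψ z).det = (fderiv ℝ ψ z).det := by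
  have hone : δ * (fderiv ℝ T.symm (T z)).det = 1 := by
    rw [← hT z, ← det_mul, C1Diffeo.fderiv_mul_fderiv_symm]
    exact LinearMap.det_id
  rw [conjDeriv, det_mul, det_mul, hT, mul_right_comm, hone, one_mul]

theorem conj_mem_iff {T ψ : C1Diffeo V} {U Ω : Set V} (hTU : MapsTo T U Ω)
    (hψU : ∀ z, ψ z ∈ U ↔ z ∈ U) (hψ : ∀ z, T z ∈ Ω → z ∉ U → ψ z = z) (z : V) :
    T (ψ z) ∈ Ω ↔ T z ∈ Ω := by
  by_cases hz : z ∈ U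
  · exact iff_of_true (hTU ((hψU z).2 hz)) (hTU hz)
  · refine ⟨fun h => ?_, fun h => (hψ z h hz).symm ▸ h⟩
    have hfix : ψ z = z := ψ.injective (hψ (ψ z) h (mt (hψU z).1 hz))
    exact hfix ▸ h

theorem hasCompactSupport_conj_sub {T ψ : C1Diffeo V}
    (hψ : HasCompactSupport fun z => ψ z - z) :
    HasCompactSupport fun x => T.symm.trans (ψ.trans T) x - x := by
  refine HasCompactSupport.intro (hψ.image T.continuous) fun x hx => ?_
  obtain ⟨z, rfl⟩ := T.surjective x
  have hz : ψ z = z :=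
    sub_eq_zero.1 (image_eq_zero_of_notMem_tsupport (f := fun z => ψ z - z)
      fun h => hx (mem_image_of_mem T h))
  simp [hz]

variable [FiniteDimensional ℝ V] [MeasurableSpace V] [BorelSpace V]

/-- Every linear map with positive determinant minimizes the energy with density `Φ` among its
compositions with the orientation-preserving diffeomorphisms of the whole space that preserve `Ω`
and are the identity off a compact set. -/
def IsStable (Ω : Set V) (Φ : (V →L[ℝ] V) → ℝ) : Prop :=
  ∀ A : V →L[ℝ] V, 0 < A.det → ∀ φ : C1Diffeo V, (∀ x, φ x ∈ Ω ↔ x ∈ Ω) →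
    (HasCompactSupport fun x => φ x - x) → (∀ x, 0 < (fderiv ℝ φ x).det) →
      0 ≤ ∫ x in Ω, (Φ (A * fderiv ℝ φ x) - Φ A)

variable {Ω : Set V} {Φ : (V →L[ℝ] V) → ℝ}

theorem setIntegral_image_of_det_eq {T : C1Diffeo V} {δ : ℝ} (hT : ∀ z, (fderiv ℝ T z).det = δ)
    {U : Set V} (hU : MeasurableSet U) (f : V → ℝ) :
    ∫ x in T '' U, f x = |δ| * ∫ z in U, f (T z) := by
  rw [integral_image_eq_integral_abs_det_fderiv_smul volume hU
    (fun z _ => (C1Diffeo.hasFDerivAt T z).hasFDerivWithinAt) T.injective.injOn]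
  simp only [hT, smul_eq_mul, integral_const_mul]

theorem IsStable.setIntegral_conjDeriv_nonneg (hst : IsStable Ω Φ) (hΩ : IsOpen Ω)
    {T ψ : C1Diffeo V} {δ : ℝ} (hT : ∀ z, (fderiv ℝ T z).det = δ)
    (hψc : HasCompactSupport fun z => ψ z - z) (hψdet : ∀ z, 0 < (fderiv ℝ ψ z).det)
    {U : Set V} (hU : IsOpen U) (hTU : MapsTo T U Ω)
    (hψU : ∀ z, ψ z ∈ U ↔ z ∈ U)
    (hψ : ∀ z, T z ∈ Ω → z ∉ U → ψ z = z ∧ fderiv ℝ ψ z = 1) {B : V →L[ℝ] V} (hB : 0 < B.det) :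
    0 ≤ ∫ z in U, (Φ (B * conjDeriv T ψ z) - Φ B) := by
  have hδ : δ ≠ 0 := by
    rintro rfl
    have hone := congrArg ContinuousLinearMap.det (C1Diffeo.fderiv_mul_fderiv_symm T 0)
    rw [det_mul, hT, zero_mul] at hone
    exact zero_ne_one (hone.trans LinearMap.det_id)
  have hint := hst B hB (T.symm.trans (ψ.trans T))
    (T.surjective.forall.2 fun z => by
      simpa using conj_mem_iff hTU hψU (fun z hz hzU => (hψ z hz hzU).1) z)
    (hasCompactSupport_conj_sub hψc)
    (T.surjective.forall.2 fun z => by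
      rw [Diffeomorph.coe_toEquiv, fderiv_conj, det_conjDeriv hT]
      exact hψdet z)
  rw [setIntegral_eq_of_subset_of_forall_sdiff_eq_zero hΩ.measurableSet hTU.image_subset,
    setIntegral_image_of_det_eq hT hU.measurableSet] at hint
  · simp only [fderiv_conj] at hint
    exact nonneg_of_mul_nonneg_right hint (abs_pos.2 hδ)
  · rintro x ⟨hx, hxU⟩
    obtain ⟨z, rfl⟩ := T.surjective x
    obtain ⟨hz, hz'⟩ := hψ z hx fun hzU => hxU ⟨z, hzU, rfl⟩
    rw [Diffeomorph.coe_toEquiv, fderiv_conj, conjDeriv_eq_one hz hz', mul_one, sub_self]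

end Stability

section Convexity

variable {V : Type*} [NormedAddCommGroup V] [InnerProductSpace ℝ V]

open scoped Manifold in
/-- The affine diffeomorphism `z ↦ x + ρ • z`. -/
def dilation (x : V) {ρ : ℝ} (hρ : ρ ≠ 0) : C1Diffeo V where
  toFun z := x + ρ • z
  invFun y := ρ⁻¹ • (y - x)
  left_inv z := by simp [smul_smul, hρ]
  right_inv y := by simp [smul_smul, hρ]
  contMDiff_toFun := ContDiff.contMDiff (by change ContDiff ℝ 1 fun z => x + ρ • z; fun_prop)
  contMDiff_invFun := ContDiff.contMDiff (by change ContDiff ℝ 1 fun y => ρ⁻¹ • (y - x); fun_prop)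

theorem dilation_apply (x : V) {ρ : ℝ} (hρ : ρ ≠ 0) (z : V) : dilation x hρ z = x + ρ • z := rfl

theorem fderiv_dilation (x : V) {ρ : ℝ} (hρ : ρ ≠ 0) (z : V) :
    fderiv ℝ (dilation x hρ) z = ρ • (1 : V →L[ℝ] V) :=
  (((hasFDerivAt_id z).const_smul ρ).const_add x).fderiv

theorem fderiv_dilation_symm (x : V) {ρ : ℝ} (hρ : ρ ≠ 0) (y : V) :
    fderiv ℝ (dilation x hρ).symm y = ρ⁻¹ • (1 : V →L[ℝ] V) :=
  (((hasFDerivAt_id y).sub_const x).const_smul ρ⁻¹).fderiv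

theorem conjDeriv_dilation (x : V) {ρ : ℝ} (hρ : ρ ≠ 0) (ψ : C1Diffeo V) (z : V) :
    conjDeriv (dilation x hρ) ψ z = fderiv ℝ ψ z := by
  simp [conjDeriv, fderiv_dilation, fderiv_dilation_symm, smul_smul, hρ]

variable [FiniteDimensional ℝ V]

theorem exists_det_eq {e : V} (he : ‖e‖ = 1) (t : ℝ) : ∃ A : V →L[ℝ] V, A.det = t :=
  ⟨1 + (innerSL ℝ e).smulRight ((t - 1) • e), by simp [det_one_add_smulRight, he]⟩

variable [MeasurableSpace V] [BorelSpace V] {Ω : Set V} {Φ : (V →L[ℝ] V) → ℝ}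

theorem IsStable.setIntegral_ball_nonneg (hst : IsStable Ω Φ) (hΩ : IsOpen Ω)
    (hne : Ω.Nonempty) {v : V} (hv : ‖v‖ ≤ 1 / 8) {B : V →L[ℝ] V} (hB : 0 < B.det) :
    0 ≤ ∫ z in Metric.ball 0 1, (Φ (B * (1 + (bumpDeriv z).smulRight v)) - Φ B) := by
  obtain ⟨x, hx⟩ := hne
  obtain ⟨ρ, hρ, hball⟩ := Metric.isOpen_iff.1 hΩ x hx
  have hint := hst.setIntegral_conjDeriv_nonneg hΩ (T := dilation x hρ.ne') (U := Metric.ball 0 1)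
    (fun z => by rw [fderiv_dilation]) (hasCompactSupport_bumpDiffeo_sub hv)
    (det_fderiv_bumpDiffeo_pos hv) Metric.isOpen_ball
    (fun z hz => hball ?_)
    (fun z => by simpa only [mem_ball_zero_iff] using norm_bumpDiffeo_lt_one_iff hv z)
    (fun z _ hz => ?_) hB
  · simpa only [conjDeriv_dilation, fderiv_bumpDiffeo] using hint
  · rw [mem_ball_zero_iff] at hz
    rw [dilation_apply, mem_ball_iff_norm, add_sub_cancel_left, norm_smul,
      Real.norm_of_nonneg hρ.le]
    exact mul_lt_of_lt_one_right hρ hz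
  · rw [mem_ball_zero_iff, not_lt] at hz
    exact ⟨bumpDiffeo_of_one_le_norm hv hz, fderiv_bumpDiffeo_of_one_le_norm hv hz⟩

theorem IsStable.convexOn [Nontrivial V] (hst : IsStable Ω Φ) (hΩ : IsOpen Ω) (hne : Ω.Nonempty)
    {h : ℝ → ℝ} (hh : ContinuousOn h (Ioi 0)) (hΦ : ∀ A : V →L[ℝ] V, 0 < A.det → Φ A = h A.det) :
    ConvexOn ℝ (Ioi 0) h := by
  obtain ⟨e, he⟩ := exists_norm_eq V zero_le_one
  refine convexOn_of_eventually_setIntegral_nonneg (μ := volume) (q := fun z : V => bumpDeriv z e)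
    Metric.isOpen_ball measure_ball_lt_top.ne
    (continuous_bumpDeriv.clm_apply continuous_const).continuousOn
    (fun z _ => abs_bumpDeriv_apply_le z e) (setIntegral_ball_bumpDeriv_apply volume e)
    (mem_ball_zero_iff.2 ?_) (bumpDeriv_neg_half_smul_apply_pos he) (convex_Ioi 0) hh ?_
  · rw [norm_smul, he]
    norm_num
  intro d (hd : 0 < d)
  obtain ⟨A, hA⟩ := exists_det_eq he d
  have hsmall : ∀ᶠ t in 𝓝[>] (0 : ℝ), ‖(t / d) • e‖ < 1 / 8 :=
    (Continuous.tendsto' (by fun_prop) _ _ (by simp)).mono_left nhdsWithin_le_nhds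
      |>.eventually_lt_const (by norm_num : (0 : ℝ) < 1 / 8)
  filter_upwards [hsmall] with t ht
  have hint := hst.setIntegral_ball_nonneg hΩ hne ht.le (B := A) (hA ▸ hd)
  refine hint.trans_eq (integral_congr_ae (.of_forall fun z => ?_))
  have hdet : (A * (1 + (bumpDeriv z).smulRight ((t / d) • e))).det =
      d * (1 + bumpDeriv z ((t / d) • e)) := by rw [det_mul, det_one_add_smulRight, hA]
  have hpos : 0 < d * (1 + bumpDeriv z ((t / d) • e)) :=
    mul_pos hd (one_add_bumpDeriv_apply_pos ht.le z)
  have hshift : d * (1 + bumpDeriv z ((t / d) • e)) = d + t * bumpDeriv z e := by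
    rw [map_smul, smul_eq_mul]
    field_simp
  beta_reduce
  rw [hΦ _ (hdet ▸ hpos), hΦ A (hA ▸ hd), hdet, hA, hshift]

end Convexity

section Blowup

variable {V : Type*} [NormedAddCommGroup V] [InnerProductSpace ℝ V] {e : V}

/-- The anisotropic scaling by `r` orthogonally to the unit vector `e` and by `r ^ 2` along `e`. -/
def scaling (e : V) (r : ℝ) : V →L[ℝ] V :=
  r • (1 : V →L[ℝ] V) + (r ^ 2 - r) • (innerSL ℝ e).smulRight e

theorem scaling_apply (e : V) (r : ℝ) (z : V) :
    scaling e r z = r • z + ((r ^ 2 - r) * ⟪e, z⟫_ℝ) • e := by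
  simp [scaling, smul_smul]

theorem inner_scaling (he : ‖e‖ = 1) (r : ℝ) (z : V) :
    ⟪e, scaling e r z⟫_ℝ = r ^ 2 * ⟪e, z⟫_ℝ := by
  rw [scaling_apply, inner_add_right, real_inner_smul_right, real_inner_smul_right,
    real_inner_self_eq_norm_sq, he]
  ring

theorem scaling_scaling (he : ‖e‖ = 1) (r s : ℝ) (z : V) :
    scaling e r (scaling e s z) = scaling e (r * s) z := by
  rw [scaling_apply e r, inner_scaling he, scaling_apply, scaling_apply]
  module

theorem scaling_one (e : V) : scaling e 1 = 1 := by simp [scaling]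

theorem scaling_zero (e : V) : scaling e 0 = 0 := by simp [scaling]

theorem continuous_scaling (e : V) : Continuous (scaling e) := by
  unfold scaling
  fun_prop

theorem scaling_scaling_inv (he : ‖e‖ = 1) {r : ℝ} (hr : r ≠ 0) (z : V) :
    scaling e r (scaling e r⁻¹ z) = z := by
  rw [scaling_scaling he, mul_inv_cancel₀ hr, scaling_one, one_apply_eq_self]

theorem scaling_inv_scaling (he : ‖e‖ = 1) {r : ℝ} (hr : r ≠ 0) (z : V) :
    scaling e r⁻¹ (scaling e r z) = z := by
  rw [scaling_scaling he, inv_mul_cancel₀ hr, scaling_one, one_apply_eq_self]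

theorem scaling_mul_one_add_smulRight_mul_scaling_inv (he : ‖e‖ = 1) {r : ℝ} (hr : r ≠ 0)
    (m : V →L[ℝ] ℝ) {τ : V} (hτ : ⟪e, τ⟫_ℝ = 0) :
    scaling e r * (1 + m.smulRight (r • τ)) * scaling e r⁻¹ =
      1 + (r • m + ((1 - r) * m e) • innerSL ℝ e).smulRight τ := by
  ext v
  have hm : r * (r * m (scaling e r⁻¹ v)) = r * m v + (1 - r) * m e * ⟪e, v⟫_ℝ := by
    simp only [scaling_apply, map_add, map_smul, smul_eq_mul]
    field_simp
  have hscale : scaling e r τ = r • τ := by rw [scaling_apply, hτ, mul_zero, zero_smul, add_zero]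
  simp only [mul_apply_eq_comp, add_apply,
    one_apply_eq_self, ContinuousLinearMap.smulRight_apply,
    smul_apply, map_add, map_smul, scaling_scaling_inv he hr, hscale,
    innerSL_apply_apply, smul_eq_mul, ← hm, smul_smul]
  congr 2
  ring

/-- The `C¹` function `k` depends only on the coordinates orthogonal to the unit vector `e`, so
that `⟪e, z⟫ = k z` is the equation of a graph in the direction `e`. -/
structure IsGraphFunction (e : V) (k : V → ℝ) : Prop where
  norm_eq_one : ‖e‖ = 1
  contDiff : ContDiff ℝ 1 k
  apply_add_smul (z : V) (t : ℝ) : k (z + t • e) = k z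

/-- The blow-up of the graph of `k` around its point `x`: the coordinates in which the graph is
the hyperplane orthogonal to `e`, scaled by `scaling e r`. -/
def blowupMap (e : V) (k : V → ℝ) (x : V) (r : ℝ) (z : V) : V :=
  x + scaling e r z + (k (x + scaling e r z) - k x) • e

variable {k : V → ℝ}

theorem continuous_uncurry_blowupMap (hk : Continuous k) (x : V) :
    Continuous fun p : ℝ × V => blowupMap e k x p.1 p.2 := by
  have hscaling := continuous_scaling e
  unfold blowupMap
  fun_prop

theorem blowupMap_zero (x z : V) : blowupMap e k x 0 z = x := by
  simp [blowupMap, scaling_zero]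

namespace IsGraphFunction

theorem hasFDerivAt (hk : IsGraphFunction e k) (z : V) : HasFDerivAt k (fderiv ℝ k z) z :=
  (hk.contDiff.differentiable one_ne_zero z).hasFDerivAt

theorem fderiv_apply_self (hk : IsGraphFunction e k) (z : V) : fderiv ℝ k z e = 0 := by
  have hline : HasDerivAt (fun t : ℝ => k (z + t • e)) (fderiv ℝ k z e) 0 :=
    HasFDerivAt.comp_hasDerivAt (f := fun t : ℝ => z + t • e) 0 (by simpa using hk.hasFDerivAt z)
      (by simpa using ((hasDerivAt_id (0 : ℝ)).smul_const e).const_add z)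
  simp only [hk.apply_add_smul] at hline
  exact hline.unique (hasDerivAt_const _ _)

theorem fderiv_add_smul (hk : IsGraphFunction e k) (z : V) (t : ℝ) :
    fderiv ℝ k (z + t • e) = fderiv ℝ k z := by
  rw [← fderiv_comp_add_right]
  simp only [hk.apply_add_smul]

theorem apply_blowupMap (hk : IsGraphFunction e k) (x : V) (r : ℝ) (z : V) :
    k (blowupMap e k x r z) = k (x + scaling e r z) :=
  hk.apply_add_smul _ _

theorem inner_blowupMap_lt_iff (hk : IsGraphFunction e k) {x : V} (hx : ⟪e, x⟫_ℝ = k x) {r : ℝ}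
    (hr : 0 < r) (z : V) :
    ⟪e, blowupMap e k x r z⟫_ℝ < k (blowupMap e k x r z) ↔ ⟪e, z⟫_ℝ < 0 := by
  have hinner : ⟪e, blowupMap e k x r z⟫_ℝ = r ^ 2 * ⟪e, z⟫_ℝ + k (blowupMap e k x r z) := by
    rw [hk.apply_blowupMap, blowupMap, inner_add_right, inner_add_right, hx,
      inner_scaling hk.norm_eq_one, real_inner_smul_right, real_inner_self_eq_norm_sq,
      hk.norm_eq_one]
    ring
  rw [hinner, add_lt_iff_neg_right]
  exact smul_neg_iff_of_pos_left (pow_pos hr 2)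

open scoped Manifold in
/-- The map `blowupMap` as a diffeomorphism. -/
def blowup (hk : IsGraphFunction e k) (x : V) {r : ℝ} (hr : r ≠ 0) : C1Diffeo V where
  toFun := blowupMap e k x r
  invFun y := scaling e r⁻¹ (y - x - (k y - k x) • e)
  left_inv z := by
    beta_reduce
    rw [hk.apply_blowupMap, blowupMap, add_sub_right_comm, add_sub_cancel_right,
      add_sub_cancel_left, scaling_inv_scaling hk.norm_eq_one hr]
  right_inv y := by
    have hky : k (x + (y - x - (k y - k x) • e)) = k y := by
      rw [add_sub, add_sub_cancel, sub_eq_add_neg, ← neg_smul, hk.apply_add_smul]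
    simp only [blowupMap, scaling_scaling_inv hk.norm_eq_one hr, hky]
    module
  contMDiff_toFun := ContDiff.contMDiff <| by
    have := hk.contDiff
    change ContDiff ℝ 1 fun z => x + scaling e r z + (k (x + scaling e r z) - k x) • e
    fun_prop
  contMDiff_invFun := ContDiff.contMDiff <| by
    have := hk.contDiff
    change ContDiff ℝ 1 fun y => scaling e r⁻¹ (y - x - (k y - k x) • e)
    fun_prop

theorem blowup_apply (hk : IsGraphFunction e k) (x : V) {r : ℝ} (hr : r ≠ 0) (z : V) :
    hk.blowup x hr z = blowupMap e k x r z := rfl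

theorem fderiv_blowup (hk : IsGraphFunction e k) (x : V) {r : ℝ} (hr : r ≠ 0) (z : V) :
    fderiv ℝ (hk.blowup x hr) z =
      (1 + (fderiv ℝ k (x + scaling e r z)).smulRight e) * scaling e r := by
  have haffine : HasFDerivAt (fun z => x + scaling e r z) (scaling e r) z :=
    (scaling e r).hasFDerivAt.const_add x
  exact (haffine.add ((((hk.hasFDerivAt _).comp z haffine).sub_const _).smul_const e)).fderiv

theorem fderiv_blowup_symm (hk : IsGraphFunction e k) (x : V) {r : ℝ} (hr : r ≠ 0) (y : V) :
    fderiv ℝ (hk.blowup x hr).symm y = scaling e r⁻¹ * (1 - (fderiv ℝ k y).smulRight e) :=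
  ((scaling e r⁻¹).hasFDerivAt.comp y
    (((hasFDerivAt_id y).sub_const x).sub (((hk.hasFDerivAt y).sub_const _).smul_const e))).fderiv

end IsGraphFunction

/-- The derivative, at the point with blow-up coordinates `z`, of the diffeomorphism which is
`z ↦ z + (r * bump z) • τ` in these coordinates. In this form it extends continuously to
`r = 0`. -/
def slidingDeriv (e : V) (k : V → ℝ) (x τ : V) (r : ℝ) (z : V) : V →L[ℝ] V :=
  (1 + (fderiv ℝ k (x + scaling e r (z + bump z • r • τ))).smulRight e) *
    (1 + (r • bumpDeriv z + ((1 - r) * bumpDeriv z e) • innerSL ℝ e).smulRight τ) *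
    (1 - (fderiv ℝ k (x + scaling e r z)).smulRight e)

theorem continuous_uncurry_slidingDeriv (hk : ContDiff ℝ 1 k) (x τ : V) :
    Continuous fun p : ℝ × V => slidingDeriv e k x τ p.1 p.2 := by
  have hbump := continuous_bump (V := V)
  have hbumpDeriv := continuous_bumpDeriv (V := V)
  have hscaling := continuous_scaling e
  have hsmulRight (v : V) : Continuous fun m : V →L[ℝ] ℝ => m.smulRight v :=
    ((ContinuousLinearMap.smulRightL ℝ V V).flip v).continuous
  unfold slidingDeriv
  fun_prop

namespace IsGraphFunction

theorem det_slidingDeriv [FiniteDimensional ℝ V] (hk : IsGraphFunction e k) (x : V) {τ : V}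
    (hτ : ⟪e, τ⟫_ℝ = 0) (r : ℝ) (z : V) :
    (slidingDeriv e k x τ r z).det = 1 + r * bumpDeriv z τ := by
  simp [slidingDeriv, det_mul, det_one_add_smulRight, det_one_sub_smulRight,
    hk.fderiv_apply_self, hτ]

theorem conjDeriv_blowup_bumpDiffeo [FiniteDimensional ℝ V] (hk : IsGraphFunction e k) (x : V)
    {τ : V} (hτ : ⟪e, τ⟫_ℝ = 0) {r : ℝ} (hr : r ≠ 0) (hrτ : ‖r • τ‖ ≤ 1 / 8) (z : V) :
    conjDeriv (hk.blowup x hr) (bumpDiffeo (r • τ) hrτ) z = slidingDeriv e k x τ r z := by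
  rw [conjDeriv, fderiv_blowup, fderiv_bumpDiffeo, fderiv_blowup_symm, slidingDeriv,
    ← scaling_mul_one_add_smulRight_mul_scaling_inv hk.norm_eq_one hr _ hτ, bumpDiffeo_apply,
    blowup_apply, blowupMap, hk.fderiv_add_smul]
  simp only [mul_assoc]

theorem slidingDeriv_zero (hk : IsGraphFunction e k) (x : V) {σ : V}
    (hσ : (innerSL ℝ e - fderiv ℝ k x) σ = 0) (l : ℝ) (z : V) :
    slidingDeriv e k x (l • (σ - ⟪e, σ⟫_ℝ • e)) 0 z =
      1 + (l * bumpDeriv z e) • (innerSL ℝ e - fderiv ℝ k x).smulRight σ := by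
  have hσ' : ⟪e, σ⟫_ℝ = fderiv ℝ k x σ := by
    rwa [sub_apply, innerSL_apply_apply, sub_eq_zero] at hσ
  ext v
  simp [slidingDeriv, scaling_zero, hk.fderiv_apply_self, hk.norm_eq_one, hσ',
    inner_sub_right, real_inner_smul_right]
  module

end IsGraphFunction

end Blowup

section Boundary

variable {V : Type*} [NormedAddCommGroup V] [InnerProductSpace ℝ V] {e : V} {k : V → ℝ}

/-- Near its boundary point `x`, the set `Ω` is the region below the graph of `k` in the
direction `e`. -/
structure IsSubgraphNear (Ω : Set V) (x e : V) (k : V → ℝ) : Prop extends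
    IsGraphFunction e k where
  inner_eq : ⟪e, x⟫_ℝ = k x
  eventually_mem_iff : ∀ᶠ z in 𝓝 x, z ∈ Ω ↔ ⟪e, z⟫_ℝ < k z

/-- The open half of the unit ball below the hyperplane orthogonal to `e`. -/
def halfBall (e : V) : Set V := {z | z ∈ Metric.ball 0 1 ∧ ⟪e, z⟫_ℝ < 0}

theorem isOpen_halfBall (e : V) : IsOpen (halfBall e) :=
  Metric.isOpen_ball.inter (isOpen_lt (innerSL ℝ e).continuous continuous_const)

theorem halfBall_subset_closedBall (e : V) : halfBall e ⊆ Metric.closedBall 0 1 :=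
  fun _ hz => Metric.ball_subset_closedBall hz.1

theorem one_add_smul_smulRight_mul {m : V →L[ℝ] ℝ} {σ : V} (hσ : m σ = 0) (s t : ℝ) :
    (1 + s • m.smulRight σ) * (1 + t • m.smulRight σ) = 1 + (s + t) • m.smulRight σ := by
  ext v
  simp [hσ, add_smul, add_assoc, add_comm]

theorem exists_forall_mem_Icc_norm_smul_le (τ : V) :
    ∃ ρ > 0, ∀ r ∈ Icc (0 : ℝ) ρ, ‖r • τ‖ ≤ 1 / 8 := by
  refine ⟨1 / 8 / (‖τ‖ + 1), by positivity, fun r hr => ?_⟩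
  rw [norm_smul, Real.norm_of_nonneg hr.1]
  calc r * ‖τ‖ ≤ 1 / 8 / (‖τ‖ + 1) * (‖τ‖ + 1) :=
        mul_le_mul hr.2 (le_add_of_nonneg_right zero_le_one) (norm_nonneg τ) (by positivity)
    _ = 1 / 8 := div_mul_cancel₀ _ (by positivity)

variable [FiniteDimensional ℝ V] {Ω : Set V} {x τ : V}

theorem IsSubgraphNear.eventually_blowupMap_mem_iff (h : IsSubgraphNear Ω x e k) :
    ∀ᶠ r in 𝓝[>] (0 : ℝ), ∀ z ∈ Metric.closedBall (0 : V) 1,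
      blowupMap e k x r z ∈ Ω ↔ ⟪e, z⟫_ℝ < 0 := by
  have hnear : ∀ᶠ r in 𝓝 (0 : ℝ), ∀ z ∈ Metric.closedBall (0 : V) 1,
      blowupMap e k x r z ∈ Ω ↔ ⟪e, blowupMap e k x r z⟫_ℝ < k (blowupMap e k x r z) :=
    (isCompact_closedBall 0 1).eventually_forall_of_forall_eventually fun z _ =>
      ((continuous_uncurry_blowupMap h.contDiff.continuous x).tendsto' (0, z) x
        (blowupMap_zero x z)).eventually h.eventually_mem_iff
  filter_upwards [nhdsWithin_le_nhds hnear, self_mem_nhdsWithin] with r hr hr0 z hz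
  exact (hr z hz).trans (h.inner_blowupMap_lt_iff h.inner_eq hr0 z)

theorem bumpDiffeo_mem_halfBall_iff (hτ : ⟪e, τ⟫_ℝ = 0) (hτ' : ‖τ‖ ≤ 1 / 8) (z : V) :
    bumpDiffeo τ hτ' z ∈ halfBall e ↔ z ∈ halfBall e := by
  have hinner : ⟪e, bumpDiffeo τ hτ' z⟫_ℝ = ⟪e, z⟫_ℝ := by
    rw [bumpDiffeo_apply, inner_add_right, real_inner_smul_right, hτ, mul_zero, add_zero]
  simp only [halfBall, mem_ofPred_eq, mem_ball_zero_iff, norm_bumpDiffeo_lt_one_iff, hinner]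

theorem det_one_add_smul_smulRight {m : V →L[ℝ] ℝ} {σ : V} (hσ : m σ = 0) (t : ℝ) :
    (1 + t • m.smulRight σ).det = 1 := by
  have hsmul : t • m.smulRight σ = (t • m).smulRight σ := by ext; simp [smul_smul]
  rw [hsmul, det_one_add_smulRight, smul_apply, hσ, smul_zero, add_zero]

theorem IsGraphFunction.det_mul_slidingDeriv_pos (hk : IsGraphFunction e k) (x : V)
    (hτ : ⟪e, τ⟫_ℝ = 0) {r : ℝ} (hrτ : ‖r • τ‖ ≤ 1 / 8) {B : V →L[ℝ] V} (hB : 0 < B.det)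
    (z : V) :
    0 < (B * slidingDeriv e k x τ r z).det := by
  rw [det_mul, hk.det_slidingDeriv x hτ, ← smul_eq_mul r, ← map_smul]
  exact mul_pos hB (one_add_bumpDeriv_apply_pos hrτ z)

variable [MeasurableSpace V] [BorelSpace V] {Φ : (V →L[ℝ] V) → ℝ} {B : V →L[ℝ] V}

theorem IsStable.setIntegral_slidingDeriv_nonneg (hst : IsStable Ω Φ) (hΩ : IsOpen Ω)
    (hk : IsGraphFunction e k) (hτ : ⟪e, τ⟫_ℝ = 0) {r : ℝ} (hr : r ≠ 0) (hrτ : ‖r • τ‖ ≤ 1 / 8)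
    (hmem : ∀ z ∈ Metric.closedBall (0 : V) 1, blowupMap e k x r z ∈ Ω ↔ ⟪e, z⟫_ℝ < 0)
    (hB : 0 < B.det) :
    0 ≤ ∫ z in halfBall e, (Φ (B * slidingDeriv e k x τ r z) - Φ B) := by
  have hrτ0 : ⟪e, r • τ⟫_ℝ = 0 := by rw [real_inner_smul_right, hτ, mul_zero]
  have hdet (z : V) : (fderiv ℝ (hk.blowup x hr) z).det = (scaling e r).det := by
    rw [hk.fderiv_blowup, det_mul, det_one_add_smulRight, hk.fderiv_apply_self, add_zero, one_mul]
  have hint := hst.setIntegral_conjDeriv_nonneg hΩ hdet (hasCompactSupport_bumpDiffeo_sub hrτ)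
    (det_fderiv_bumpDiffeo_pos hrτ) (isOpen_halfBall e)
    (fun z hz => (hmem z (halfBall_subset_closedBall e hz)).2 hz.2)
    (bumpDiffeo_mem_halfBall_iff hrτ0 hrτ) (fun z hzΩ hz => ?_) hB
  · simpa only [hk.conjDeriv_blowup_bumpDiffeo x hτ hr hrτ] using hint
  · have hz1 : 1 ≤ ‖z‖ := by
      by_contra! hlt
      have hball : z ∈ Metric.ball 0 1 := mem_ball_zero_iff.2 hlt
      exact hz ⟨hball, (hmem z (Metric.ball_subset_closedBall hball)).1 hzΩ⟩
    exact ⟨bumpDiffeo_of_one_le_norm hrτ hz1, fderiv_bumpDiffeo_of_one_le_norm hrτ hz1⟩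

theorem IsStable.setIntegral_slidingDeriv_zero_nonneg (hst : IsStable Ω Φ) (hΩ : IsOpen Ω)
    (hΦ : ContinuousOn Φ {A | 0 < A.det}) (h : IsSubgraphNear Ω x e k) (hτ : ⟪e, τ⟫_ℝ = 0)
    (hB : 0 < B.det) :
    0 ≤ ∫ z in halfBall e, (Φ (B * slidingDeriv e k x τ 0 z) - Φ B) := by
  obtain ⟨ρ, hρ, hρτ⟩ := exists_forall_mem_Icc_norm_smul_le τ
  have hcont : ContinuousOn
      (fun r => ∫ z in halfBall e, (Φ (B * slidingDeriv e k x τ r z) - Φ B)) (Icc 0 ρ) := by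
    refine continuousOn_setIntegral_of_continuousOn_prod isCompact_Icc (isCompact_closedBall 0 1)
      (isOpen_halfBall e).measurableSet (halfBall_subset_closedBall e) (.sub ?_ continuousOn_const)
    exact hΦ.comp
      (continuous_const.mul (continuous_uncurry_slidingDeriv h.contDiff x τ)).continuousOn
      fun p hp => h.det_mul_slidingDeriv_pos x hτ (hρτ p.1 hp.1) hB p.2
  have hIcc : ∀ᶠ r in 𝓝[>] (0 : ℝ), r ∈ Icc 0 ρ :=
    mem_of_superset (Ioo_mem_nhdsGT hρ) Ioo_subset_Icc_self
  refine ge_of_tendsto ((hcont 0 (left_mem_Icc.2 hρ.le)).tendsto.mono_left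
    (nhdsWithin_le_iff.2 hIcc)) ?_
  filter_upwards [hIcc, self_mem_nhdsWithin, h.eventually_blowupMap_mem_iff] with r hr hr0 hmem
  exact hst.setIntegral_slidingDeriv_nonneg hΩ h.toIsGraphFunction hτ (ne_of_gt hr0) (hρτ r hr)
    hmem hB

theorem IsStable.apply_mul_shear (hst : IsStable Ω Φ) (hΩ : IsOpen Ω)
    (hΦ : ContinuousOn Φ {A | 0 < A.det}) (h : IsSubgraphNear Ω x e k) {σ : V}
    (hσ : (innerSL ℝ e - fderiv ℝ k x) σ = 0) (hB : 0 < B.det) :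
    Φ (B * (1 + (innerSL ℝ e - fderiv ℝ k x).smulRight σ)) = Φ B := by
  set m := innerSL ℝ e - fderiv ℝ k x
  have hdet (t : ℝ) : 0 < (B * (1 + t • m.smulRight σ)).det := by
    rwa [det_mul, det_one_add_smul_smulRight hσ, mul_one]
  have hcont : Continuous fun t : ℝ => Φ (B * (1 + t • m.smulRight σ)) :=
    hΦ.comp_continuous (by fun_prop) hdet
  have hmaps : MapsTo (fun z => bumpDeriv z e) (halfBall e) (Icc 0 4) := fun z hz =>
    ⟨bumpDeriv_apply_nonneg hz.2.le,
      by simpa [h.norm_eq_one] using (abs_le.1 (abs_bumpDeriv_apply_le z e)).2⟩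
  have hmem : (-(1 / 2 : ℝ)) • e ∈ halfBall e := by
    refine ⟨?_, ?_⟩
    · rw [mem_ball_zero_iff, norm_smul, h.norm_eq_one]
      norm_num
    · rw [real_inner_smul_right, real_inner_self_eq_norm_sq, h.norm_eq_one]
      norm_num
  have hconst := eq_of_forall_setIntegral_nonneg (μ := volume) (isOpen_halfBall e)
    (measure_ball_lt_top.trans_le' (measure_mono inter_subset_left)).ne
    (continuous_bumpDeriv.clm_apply continuous_const).continuousOn hmaps hmem
    (bumpDeriv_neg_half_smul_apply_pos h.norm_eq_one) hcont (fun a l => ?_) 1 0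
  · simpa only [one_smul, zero_smul, add_zero, mul_one] using hconst
  · have hτ : ⟪e, l • (σ - ⟪e, σ⟫_ℝ • e)⟫_ℝ = 0 := by
      rw [real_inner_smul_right, inner_sub_right, real_inner_smul_right,
        real_inner_self_eq_norm_sq, h.norm_eq_one]
      ring
    have hint := hst.setIntegral_slidingDeriv_zero_nonneg hΩ hΦ h hτ (hdet a)
    simp only [h.slidingDeriv_zero x hσ, mul_assoc] at hint
    simpa only [m, one_add_smul_smulRight_mul hσ] using hint

end Boundary

section ShearInvariance

open Matrix

theorem diagonal_ite_eq_one_add_single {ι R : Type*} [DecidableEq ι] [Ring R]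
    {i j : ι} (hij : i ≠ j) (a b : R) :
    (diagonal fun k => if k = i then a else if k = j then b else 1) =
      1 + single i i (a - 1) + single j j (b - 1) := by
  rw [← diagonal_one, ← diagonal_single, ← diagonal_single, diagonal_add, diagonal_add]
  congr 1
  ext k
  rcases eq_or_ne k i with rfl | hki
  · simp [hij]
  · rcases eq_or_ne k j with rfl | hkj <;> simp [*]

variable {ι F : Type*} [Fintype ι] [DecidableEq ι] [Field F]

theorem diag2n_eq_transvection_mul {i j : ι} (hij : i ≠ j) (c : F) (hc : c ≠ 0) :
    Matrix.SpecialLinearGroup.diag2n hij c hc =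
      Matrix.SpecialLinearGroup.transvection hij c *
        Matrix.SpecialLinearGroup.transvection hij.symm (-c⁻¹) *
        Matrix.SpecialLinearGroup.transvection hij (c - 1) *
        Matrix.SpecialLinearGroup.transvection hij.symm 1 *
        Matrix.SpecialLinearGroup.transvection hij (-1) := by
  have hsub : c⁻¹ * (c - 1) = 1 - c⁻¹ := by rw [mul_sub, inv_mul_cancel₀ hc, mul_one]
  obtain ⟨b, hb⟩ : ∃ b : ι → ι → Matrix ι ι F, ∀ k l x, single k l x = x • b k l :=
    ⟨fun k l => single k l 1, by simp⟩
  apply Subtype.ext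
  simp only [Matrix.SpecialLinearGroup.coe_mul, Matrix.SpecialLinearGroup.transvection_coe,
    Matrix.SpecialLinearGroup.diag2n_coe]
  rw [diagonal_ite_eq_one_add_single hij]
  simp only [mul_add, mul_one, add_mul, one_mul, single_mul_single_same, mul_neg, ne_eq, hc,
    not_false_eq_true, mul_inv_cancel₀, hij.symm, single_mul_single_of_ne, add_zero, neg_mul,
    neg_sub, hij, neg_neg, hsub]
  simp only [hb]
  module

theorem specialLinearGroup_transvection_induction [Nontrivial ι]
    {p : Matrix.SpecialLinearGroup ι F → Prop}
    (htransvection : ∀ (i j : ι) (hij : i ≠ j) (a : F),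
      p (Matrix.SpecialLinearGroup.transvection hij a))
    (hmul : ∀ S T, p S → p T → p (S * T)) (S : Matrix.SpecialLinearGroup ι F) : p S := by
  refine Matrix.SpecialLinearGroup.diagonal_transvection_induction' p S (fun i j hij c hc => ?_)
    htransvection hmul
  rw [diag2n_eq_transvection_mul]
  repeat' apply hmul
  all_goals apply htransvection

theorem inv_mul_transvection_mul {R : Type*} [CommRing R] {P : Matrix ι ι R} (hP : IsUnit P.det)
    (i j : ι) (a : R) :
    P⁻¹ * transvection i j a * P = 1 + vecMulVec (P⁻¹ *ᵥ Pi.single i a) (P.row j) := by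
  have hsingle : single i j a = vecMulVec (Pi.single i a) (Pi.single j 1) := by
    rw [← mul_one a, ← smul_eq_mul, ← smul_single, single_eq_single_vecMulVec_single,
      ← smul_vecMulVec, Pi.single_smul]
  rw [transvection, hsingle, mul_add, add_mul, mul_one, nonsing_inv_mul P hP, mul_vecMulVec,
    vecMulVec_mul, single_one_vecMul]

theorem apply_mul_conj_eq_of_shear_invariant [Nontrivial ι] {α : Type*} {f : Matrix ι ι F → α}
    {P : Matrix ι ι F} (hP : IsUnit P.det) {d : F}
    (hf : ∀ i M v, M.det = d → v ⬝ᵥ P.row i = 0 → f (M * (1 + vecMulVec v (P.row i))) = f M)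
    (S : Matrix.SpecialLinearGroup ι F) :
    ∀ M : Matrix ι ι F, M.det = d → f (M * (P⁻¹ * S * P)) = f M := by
  induction S using specialLinearGroup_transvection_induction with
  | htransvection i j hij a =>
    intro M hM
    have horth : (P⁻¹ *ᵥ Pi.single i a) ⬝ᵥ P.row j = 0 := by
      have hmulVec : (P *ᵥ (P⁻¹ *ᵥ Pi.single i a)) j = 0 := by
        rw [mulVec_mulVec, mul_nonsing_inv P hP, one_mulVec, Pi.single_eq_of_ne hij.symm]
      rw [dotProduct_comm]
      exact hmulVec
    rw [Matrix.SpecialLinearGroup.transvection_coe]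
    exact (congrArg (f <| M * ·) (inv_mul_transvection_mul hP i j a)).trans (hf j M _ hM horth)
  | hmul S T hS hT =>
    intro M hM
    have hconj : P⁻¹ * (S * T : Matrix.SpecialLinearGroup ι F) * P =
        P⁻¹ * S * P * (P⁻¹ * T * P) := by
      simp only [Matrix.SpecialLinearGroup.coe_mul, mul_assoc, mul_nonsing_inv_cancel_left P _ hP]
    have hdet : (M * (P⁻¹ * S * P)).det = d := by
      rw [Matrix.det_mul, det_conj' ((isUnit_iff_isUnit_det P).2 hP), S.2, mul_one, hM]
    rw [hconj, ← mul_assoc, hT _ hdet, hS M hM]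

theorem eq_of_det_eq_of_subsingleton [Subsingleton ι] {A B : Matrix ι ι F} (h : A.det = B.det) :
    A = B := by
  ext i j
  obtain rfl := Subsingleton.elim i j
  rwa [det_eq_elem_of_subsingleton A i, det_eq_elem_of_subsingleton B i] at h

theorem eq_of_det_eq_of_shear_invariant {α : Type*} {f : Matrix ι ι F → α} {ν : ι → ι → F}
    (hν : LinearIndependent F ν) {d : F} (hd : d ≠ 0)
    (hf : ∀ i M v, M.det = d → v ⬝ᵥ ν i = 0 → f (M * (1 + vecMulVec v (ν i))) = f M)
    {A B : Matrix ι ι F} (hA : A.det = d) (hB : B.det = d) : f A = f B := by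
  rcases subsingleton_or_nontrivial ι
  · rw [eq_of_det_eq_of_subsingleton (hA.trans hB.symm)]
  have hP : IsUnit (of ν) := linearIndependent_rows_iff_isUnit.1 hν
  have hPdet : IsUnit (of ν).det := (isUnit_iff_isUnit_det _).1 hP
  have hBdet : IsUnit B.det := isUnit_iff_ne_zero.2 (hB ▸ hd)
  have hdet : (of ν * (B⁻¹ * A) * (of ν)⁻¹).det = 1 := by
    rw [det_conj hP, Matrix.det_mul, hA, ← hB, ← Matrix.det_mul, nonsing_inv_mul B hBdet, det_one]
  have hconj := apply_mul_conj_eq_of_shear_invariant (P := of ν) hPdet hf ⟨_, hdet⟩ B hB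
  rw [← hconj]
  simp only [mul_assoc, nonsing_inv_mul _ hPdet, mul_one, nonsing_inv_mul_cancel_left _ _ hPdet,
    mul_nonsing_inv_cancel_left _ _ hBdet]

end ShearInvariance

section MatrixBridge

variable {n : ℕ}

/-- The identification of square matrices with the linear endomorphisms of Euclidean space. -/
abbrev matrixCLM (n : ℕ) : Matrix (Fin n) (Fin n) ℝ ≃⋆ₐ[ℝ] (E n →L[ℝ] E n) :=
  Matrix.toEuclideanCLM

theorem det_matrixCLM (M : Matrix (Fin n) (Fin n) ℝ) : (matrixCLM n M).det = M.det := by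
  rw [ContinuousLinearMap.det, Matrix.coe_toEuclideanCLM_eq_toEuclideanLin,
    Matrix.toEuclideanLin_eq_toLin_orthonormal, LinearMap.det_toLin]

theorem det_matrixCLM_symm (A : E n →L[ℝ] E n) : ((matrixCLM n).symm A).det = A.det := by
  rw [← det_matrixCLM, StarAlgEquiv.apply_symm_apply]

theorem matrixCLM_symm_mem_matPos {A : E n →L[ℝ] E n} (hA : 0 < A.det) :
    (matrixCLM n).symm A ∈ MatPos n :=
  hA.trans_eq (det_matrixCLM_symm A).symm

theorem continuous_matrixCLM_symm : Continuous (matrixCLM n).symm :=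
  (matrixCLM n).symm.toAlgEquiv.toLinearMap.continuous_of_finiteDimensional

theorem matrixCLM_vecMulVec (v : Fin n → ℝ) (ν : E n) :
    matrixCLM n (Matrix.vecMulVec v ν.ofLp) = (innerSL ℝ ν).smulRight (WithLp.toLp 2 v) := by
  ext u i
  rw [Matrix.ofLp_toEuclideanCLM, Matrix.vecMulVec_mulVec]
  simp [PiLp.inner_apply, dotProduct, mul_comm]

theorem matImage_eq_image_matrixCLM (M : Matrix (Fin n) (Fin n) ℝ) (Ω : Set (E n)) :
    matImage M Ω = matrixCLM n M '' Ω := rfl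

theorem grad_eq_matrixCLM_symm (y : E n → E n) (x : E n) :
    grad y x = (matrixCLM n).symm (fderiv ℝ y x) := by
  rw [eq_comm, StarAlgEquiv.symm_apply_eq]
  refine ContinuousLinearMap.coe_injective
    ((EuclideanSpace.basisFun (Fin n) ℝ).toBasis.ext fun j => ?_)
  ext i
  simp [grad]

theorem det_grad (y : E n → E n) (x : E n) : (grad y x).det = (fderiv ℝ y x).det := by
  rw [grad_eq_matrixCLM_symm, det_matrixCLM_symm]

theorem continuousOn_comp_matrixCLM_symm {Ψ : Matrix (Fin n) (Fin n) ℝ → ℝ}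
    (hΨ : ContinuousOn Ψ (MatPos n)) :
    ContinuousOn (Ψ ∘ (matrixCLM n).symm) {A | 0 < A.det} :=
  hΨ.comp continuous_matrixCLM_symm.continuousOn fun _ => matrixCLM_symm_mem_matPos

end MatrixBridge

section ExtAverage

variable {n : ℕ} {Ω : Set (E n)}

theorem extAverage_of_integrableOn {f : E n → ℝ} (hf : IntegrableOn f Ω) :
    extAverage Ω f = ((⨍ x in Ω, f x : ℝ) : EReal) := by
  have hf' := Integrable.to_average hf
  have hneg : ∫⁻ x, ENNReal.ofReal (-f x) ∂(volume.restrict Ω univ)⁻¹ • volume.restrict Ω ≠ ⊤ :=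
    hf'.neg.lintegral_lt_top.ne
  rw [average, integral_eq_lintegral_pos_part_sub_lintegral_neg_part hf', EReal.coe_sub,
    EReal.coe_ennreal_toReal hf'.lintegral_lt_top.ne, EReal.coe_ennreal_toReal hneg]
  rfl

theorem extAverage_mono (hΩ : MeasurableSet Ω) {f g : E n → ℝ} (h : ∀ x ∈ Ω, f x ≤ g x) :
    extAverage Ω f ≤ extAverage Ω g := by
  have hle : ∀ᵐ x ∂(volume.restrict Ω univ)⁻¹ • volume.restrict Ω, f x ≤ g x :=
    Measure.ae_smul_measure ((ae_restrict_mem hΩ).mono h) _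
  refine EReal.sub_le_sub (EReal.coe_ennreal_le_coe_ennreal_iff.2 (lintegral_mono_ae ?_))
    (EReal.coe_ennreal_le_coe_ennreal_iff.2 (lintegral_mono_ae ?_))
  · exact hle.mono fun x hx => ENNReal.ofReal_le_ofReal hx
  · exact hle.mono fun x hx => ENNReal.ofReal_le_ofReal (neg_le_neg hx)

theorem coe_le_extAverage_iff (hΩ0 : volume Ω ≠ 0) (hΩt : volume Ω ≠ ⊤) {f : E n → ℝ} {c : ℝ}
    (hf : IntegrableOn f Ω) :
    (c : EReal) ≤ extAverage Ω f ↔ 0 ≤ ∫ x in Ω, (f x - c) := by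
  have hΩpos : 0 < volume.real Ω := ENNReal.toReal_pos hΩ0 hΩt
  rw [extAverage_of_integrableOn hf, EReal.coe_le_coe_iff, setAverage_eq, smul_eq_mul,
    le_inv_mul_iff₀ hΩpos, integral_sub hf (integrableOn_const hΩt),
    setIntegral_const, smul_eq_mul, sub_nonneg]

end ExtAverage

section Jensen

theorem exists_subgradient_of_mem_interior {s : Set ℝ} {h : ℝ → ℝ} (hh : ConvexOn ℝ s h) {d : ℝ}
    (hd : d ∈ interior s) : ∃ c : ℝ, ∀ t ∈ s, h d + c * (t - d) ≤ h t := by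
  refine ⟨derivWithin h (Ioi d) d, fun t ht => ?_⟩
  rcases lt_trichotomy t d with htd | rfl | htd
  · have hslope := (hh.slope_le_leftDeriv_of_mem_interior ht hd htd).trans
      (hh.leftDeriv_le_rightDeriv_of_mem_interior hd)
    rw [slope_def_field, div_le_iff₀ (by linarith)] at hslope
    linarith
  · simp
  · have hslope := hh.rightDeriv_le_slope_of_mem_interior hd ht htd
    rw [slope_def_field, le_div_iff₀ (by linarith)] at hslope
    linarith

variable {n : ℕ} {Ω : Set (E n)}

theorem coe_apply_setAverage_le_extAverage (hΩ : MeasurableSet Ω) (hΩ0 : volume Ω ≠ 0)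
    (hΩt : volume Ω ≠ ⊤) {s : Set ℝ} {h : ℝ → ℝ} (hh : ConvexOn ℝ s h) {g : E n → ℝ}
    (hg : IntegrableOn g Ω) (hgs : ∀ x ∈ Ω, g x ∈ s) (hd : ⨍ x in Ω, g x ∈ interior s) :
    ((h (⨍ x in Ω, g x) : ℝ) : EReal) ≤ extAverage Ω fun x => h (g x) := by
  obtain ⟨c, hc⟩ := exists_subgradient_of_mem_interior hh hd
  have : IsFiniteMeasure (volume.restrict Ω) := isFiniteMeasure_restrict.2 hΩt
  refine le_trans ?_ (extAverage_mono hΩ fun x hx => hc _ (hgs x hx))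
  refine (coe_le_extAverage_iff hΩ0 hΩt ((integrable_const _).add
    ((hg.sub (integrable_const _)).const_mul c))).2 (le_of_eq ?_)
  calc 0 = c * ∫ x in Ω, (g x - ⨍ x in Ω, g x) := by rw [integral_sub_average, mul_zero]
    _ = ∫ x in Ω, c * (g x - ⨍ x in Ω, g x) := (integral_const_mul _ _).symm
    _ = ∫ x in Ω, (h (⨍ x in Ω, g x) + c * (g x - ⨍ x in Ω, g x) - h (⨍ x in Ω, g x)) := by
      simp only [add_sub_cancel_left]

variable {V : Type*} [NormedAddCommGroup V] [NormedSpace ℝ V] [FiniteDimensional ℝ V]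
  [MeasurableSpace V] [BorelSpace V] {μ : Measure V} [μ.IsAddHaarMeasure] {s : Set V}
  {f : V → V} {f' : V → V →L[ℝ] V}

theorem integrableOn_det (hs : MeasurableSet s) (hf : ∀ x ∈ s, HasFDerivWithinAt f (f' x) s x)
    (hinj : InjOn f s) (hpos : ∀ x ∈ s, 0 < (f' x).det) (hfin : μ (f '' s) ≠ ⊤) :
    IntegrableOn (fun x => (f' x).det) s μ := by
  have habs := (integrableOn_image_iff_integrableOn_abs_det_fderiv_smul μ hs hf hinj
    fun _ => (1 : ℝ)).1 (integrableOn_const hfin)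
  refine habs.congr_fun (fun x hx => ?_) hs
  simp [abs_of_pos (hpos x hx)]

theorem setIntegral_det (hs : MeasurableSet s) (hf : ∀ x ∈ s, HasFDerivWithinAt f (f' x) s x)
    (hinj : InjOn f s) (hpos : ∀ x ∈ s, 0 < (f' x).det) :
    ∫ x in s, (f' x).det ∂μ = μ.real (f '' s) := by
  have himage := integral_image_eq_integral_abs_det_fderiv_smul μ hs hf hinj fun _ => (1 : ℝ)
  rw [setIntegral_const, smul_eq_mul, mul_one] at himage
  rw [himage]
  refine setIntegral_congr_fun hs fun x hx => ?_
  simp [abs_of_pos (hpos x hx)]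

end Jensen

section Admissible

variable {n : ℕ} {Ω : Set (E n)} {M : Matrix (Fin n) (Fin n) ℝ} {y : E n → E n}

theorem IsOrientationPreservingDiffeo.image_eq {U V : Set (E n)}
    (hy : IsOrientationPreservingDiffeo U V y) : y '' U = V := by
  obtain ⟨g, -, hg, hinv⟩ := hy.exists_inverse
  exact (hinv.bijOn hy.mapsTo hg).image_eq

theorem IsOrientationPreservingDiffeo.injOn {U V : Set (E n)}
    (hy : IsOrientationPreservingDiffeo U V y) : InjOn y U := by
  obtain ⟨g, -, -, hinv⟩ := hy.exists_inverse
  exact hinv.1.injOn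

theorem IsOrientationPreservingDiffeo.hasFDerivWithinAt {U V : Set (E n)} (hU : IsOpen U)
    (hy : IsOrientationPreservingDiffeo U V y) {x : E n} (hx : x ∈ U) :
    HasFDerivWithinAt y (fderiv ℝ y x) U x :=
  ((hy.contDiffOn.contDiffAt (hU.mem_nhds hx)).differentiableAt
    one_ne_zero).hasFDerivAt.hasFDerivWithinAt

theorem volume_matImage (hM : M ∈ MatPos n) :
    volume (matImage M Ω) = ENNReal.ofReal M.det * volume Ω := by
  rw [matImage_eq_image_matrixCLM, Measure.addHaar_image_continuousLinearMap,
    ← abs_of_pos (show 0 < M.det from hM), ← det_matrixCLM]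

theorem measureReal_matImage (hM : M ∈ MatPos n) :
    volume.real (matImage M Ω) = M.det * volume.real Ω := by
  rw [measureReal_def, volume_matImage hM, ENNReal.toReal_mul, ENNReal.toReal_ofReal (le_of_lt hM),
    measureReal_def]

theorem integrableOn_det_grad (hΩ : IsOpen Ω) (hΩt : volume Ω ≠ ⊤) (hM : M ∈ MatPos n)
    (hy : y ∈ admissible Ω M) : IntegrableOn (fun x => (grad y x).det) Ω := by
  simp only [det_grad]
  refine integrableOn_det hΩ.measurableSet (fun x hx => hy.hasFDerivWithinAt hΩ hx) hy.injOn
    (fun x hx => det_grad y x ▸ hy.det_pos x hx) ?_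
  rw [hy.image_eq, volume_matImage hM]
  exact ENNReal.mul_ne_top ENNReal.ofReal_ne_top hΩt

theorem setAverage_det_grad (hΩ : IsOpen Ω) (hΩ0 : volume Ω ≠ 0) (hΩt : volume Ω ≠ ⊤)
    (hM : M ∈ MatPos n) (hy : y ∈ admissible Ω M) : ⨍ x in Ω, (grad y x).det = M.det := by
  have hΩpos : 0 < volume.real Ω := ENNReal.toReal_pos hΩ0 hΩt
  simp only [det_grad]
  rw [setAverage_eq, setIntegral_det hΩ.measurableSet (fun x hx => hy.hasFDerivWithinAt hΩ hx)
    hy.injOn (fun x hx => det_grad y x ▸ hy.det_pos x hx), hy.image_eq,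
    measureReal_matImage hM, smul_eq_mul, mul_comm M.det,
    inv_mul_cancel_left₀ hΩpos.ne']

theorem coe_le_extAverage_of_convexOn (hΩ : IsOpen Ω) (hne : Ω.Nonempty) (hΩt : volume Ω ≠ ⊤)
    {h : ℝ → ℝ} (hh : ConvexOn ℝ (Ioi 0) h) (hM : M ∈ MatPos n) (hy : y ∈ admissible Ω M) :
    ((h M.det : ℝ) : EReal) ≤ extAverage Ω fun x => h (grad y x).det := by
  have hΩ0 := (hΩ.measure_pos volume hne).ne'
  have havg := setAverage_det_grad hΩ hΩ0 hΩt hM hy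
  rw [← havg]
  refine coe_apply_setAverage_le_extAverage hΩ.measurableSet hΩ0 hΩt hh
    (integrableOn_det_grad hΩ hΩt hM hy) hy.det_pos ?_
  rw [havg, interior_Ioi]
  exact hM

theorem grad_comp (A : E n →L[ℝ] E n) (φ : C1Diffeo (E n)) (x : E n) :
    grad (fun x => A (φ x)) x = (matrixCLM n).symm (A * fderiv ℝ φ x) := by
  rw [grad_eq_matrixCLM_symm]
  exact congrArg _ (A.hasFDerivAt.comp x (φ.hasFDerivAt x)).fderiv

theorem comp_mem_admissible {A : E n →L[ℝ] E n} (hA : 0 < A.det) {φ : C1Diffeo (E n)}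
    (hφ : ∀ x, φ x ∈ Ω ↔ x ∈ Ω) (hdet : ∀ x, 0 < (fderiv ℝ φ x).det) :
    (fun x => A (φ x)) ∈ admissible Ω ((matrixCLM n).symm A) := by
  have himage : matImage ((matrixCLM n).symm A) Ω = A '' Ω := by
    rw [matImage_eq_image_matrixCLM, StarAlgEquiv.apply_symm_apply]
  let B : E n ≃L[ℝ] E n := A.toContinuousLinearEquivOfDetNeZero hA.ne'
  have hB (z : E n) : B.symm (A z) = z := B.symm_apply_apply z
  have hleft (x : E n) : φ.symm (B.symm (A (φ x))) = x := by rw [hB, φ.symm_apply_apply]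
  refine ⟨(A.contDiff.comp φ.contDiff).contDiffOn,
    fun x hx => himage ▸ mem_image_of_mem A ((hφ x).2 hx),
    ⟨φ.symm ∘ B.symm, (φ.symm.contDiff.comp B.symm.contDiff).contDiffOn, ?_,
      fun x _ => hleft x, ?_⟩, fun x _ => ?_⟩
  · rw [himage]
    rintro _ ⟨x, hx, rfl⟩
    rw [← hφ]
    simpa [hB] using hx
  · rw [himage]
    rintro _ ⟨x, -, rfl⟩
    simp [hB]
  · rw [grad_comp, det_matrixCLM_symm, det_mul]
    exact mul_pos hA (hdet x)

theorem integrableOn_of_hasCompactSupport_sub {X : Type*} [TopologicalSpace X] [MeasurableSpace X]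
    [OpensMeasurableSpace X] {μ : Measure X} [IsFiniteMeasureOnCompacts μ] {s : Set X}
    (hs : μ s ≠ ⊤) {f : X → ℝ} (hf : Continuous f) {c : ℝ}
    (hc : HasCompactSupport fun x => f x - c) : IntegrableOn f s μ := by
  have hsub : IntegrableOn (fun x => f x - c) s μ :=
    ((hf.sub continuous_const).integrable_of_hasCompactSupport hc).integrableOn
  refine (hsub.add (integrableOn_const hs)).congr_fun_ae (.of_forall fun x => ?_)
  exact sub_add_cancel (f x) c

theorem isStable_of_coe_le_extAverage (hΩ0 : volume Ω ≠ 0) (hΩt : volume Ω ≠ ⊤)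
    {Ψ : Matrix (Fin n) (Fin n) ℝ → ℝ} (hΨ : ContinuousOn Ψ (MatPos n))
    (h : ∀ M ∈ MatPos n, ∀ y ∈ admissible Ω M,
      ((Ψ M : ℝ) : EReal) ≤ extAverage Ω fun x => Ψ (grad y x)) :
    IsStable Ω (Ψ ∘ (matrixCLM n).symm) := by
  intro A hA φ hφ hφc hdet
  have hle := h _ (matrixCLM_symm_mem_matPos hA) _ (comp_mem_admissible hA hφ hdet)
  simp only [grad_comp] at hle
  refine (coe_le_extAverage_iff hΩ0 hΩt ?_).1 hle
  have hcont : Continuous fun x => Ψ ((matrixCLM n).symm (A * fderiv ℝ φ x)) :=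
    (continuousOn_comp_matrixCLM_symm hΨ).comp_continuous
      (continuous_const.mul (φ.contDiff.continuous_fderiv one_ne_zero))
      fun x => by rw [mem_ofPred_eq, det_mul]; exact mul_pos hA (hdet x)
  refine integrableOn_of_hasCompactSupport_sub hΩt hcont (c := Ψ ((matrixCLM n).symm A)) ?_
  refine (hφc.fderiv (𝕜 := ℝ)).mono fun x hx hderiv => hx ?_
  have hid : HasFDerivAt (fun z => φ z - z) (fderiv ℝ φ x - 1) x :=
    (C1Diffeo.hasFDerivAt φ x).sub (hasFDerivAt_id x)
  rw [hid.fderiv, sub_eq_zero] at hderiv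
  simp only [hderiv, mul_one, Function.comp_apply, sub_self]

end Admissible

section OutwardNormal

variable {n : ℕ} {Ω : Set (E n)} {x e : E n} {f : (Submodule.span ℝ {e})ᗮ → ℝ}

theorem IsC1SubgraphNear.isSubgraphNear (h : IsC1SubgraphNear Ω x e f) (hx : x ∈ frontier Ω) :
    IsSubgraphNear Ω x e fun z => f ((Submodule.span ℝ {e})ᗮ.orthogonalProjectionOnto z) := by
  obtain ⟨he, hf, ε, hε, hsub, hfr⟩ := h
  have horth : (Submodule.span ℝ {e})ᗮ.orthogonalProjectionOnto e = 0 := by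
    rw [Submodule.orthogonalProjectionOnto_eq_zero_iff]
    exact Submodule.le_orthogonal_orthogonal _ (Submodule.mem_span_singleton_self e)
  refine ⟨⟨he, hf.comp (ContinuousLinearMap.contDiff _), fun z t => ?_⟩,
    (hfr.subset ⟨hx, Metric.mem_ball_self hε⟩).2, ?_⟩
  · simp only [map_add, map_smul, horth, smul_zero, add_zero]
  · filter_upwards [Metric.ball_mem_nhds x hε] with z hz
    exact ⟨fun hzΩ => (hsub.subset ⟨hzΩ, hz⟩).2, fun hzf => (hsub.superset ⟨hz, hzf⟩).1⟩

theorem innerSL_sub_fderiv_comp_orthogonalProjectionOnto {V : Type*} [NormedAddCommGroup V]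
    [InnerProductSpace ℝ V] (K : Submodule ℝ V) [CompleteSpace K] {f : K → ℝ} {x : V}
    (hf : DifferentiableAt ℝ f (K.orthogonalProjectionOnto x)) (e : V) :
    innerSL ℝ e - fderiv ℝ (fun z => f (K.orthogonalProjectionOnto z)) x =
      innerSL ℝ (e - ((gradient f (K.orthogonalProjectionOnto x) : K) : V)) := by
  have hcomp := (hf.hasFDerivAt.comp x K.orthogonalProjectionOnto.hasFDerivAt).fderiv
  ext u
  rw [sub_apply, innerSL_apply_apply, innerSL_apply_apply, inner_sub_left,
    ← Submodule.inner_orthogonalProjectionOnto_eq_of_mem_left, inner_gradient_left]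
  exact congrArg (⟪e, u⟫_ℝ - ·) (DFunLike.congr_fun hcomp u)

theorem IsStable.apply_mul_shear_of_isC1OutwardNormal {Φ : (E n →L[ℝ] E n) → ℝ}
    (hst : IsStable Ω Φ) (hΩ : IsOpen Ω) (hΦ : ContinuousOn Φ {A | 0 < A.det}) {ν : E n}
    (hν : IsC1OutwardNormal Ω x ν) {v : E n} (hv : ⟪ν, v⟫_ℝ = 0) {B : E n →L[ℝ] E n}
    (hB : 0 < B.det) : Φ (B * (1 + (innerSL ℝ ν).smulRight v)) = Φ B := by
  obtain ⟨hx, e, f, hf, w, hw, rfl⟩ := hν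
  have hw' := innerSL_sub_fderiv_comp_orthogonalProjectionOnto (x := x) (Submodule.span ℝ {e})ᗮ
    (hf.contDiff.differentiable one_ne_zero _) e
  rw [← hw] at hw'
  have hshear : (innerSL ℝ (‖w‖⁻¹ • w)).smulRight v = (innerSL ℝ w).smulRight (‖w‖⁻¹ • v) := by
    ext1 u
    simp [smul_smul, mul_comm]
  rw [hshear, ← hw']
  refine hst.apply_mul_shear hΩ hΦ (hf.isSubgraphNear hx) ?_ hB
  rwa [hw', innerSL_apply_apply, real_inner_smul_right, ← real_inner_smul_left]

end OutwardNormal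

section Rigidity

variable {n : ℕ} {Ω : Set (E n)} {Ψ : Matrix (Fin n) (Fin n) ℝ → ℝ}

theorem eq_of_det_eq_of_isStable (hst : IsStable Ω (Ψ ∘ (matrixCLM n).symm)) (hΩ : IsOpen Ω)
    (hΨ : ContinuousOn Ψ (MatPos n))
    (hbdry : 1 < n → ∃ x ν : Fin n → E n,
      (∀ i, IsC1OutwardNormal Ω (x i) (ν i)) ∧ Submodule.span ℝ (range ν) = ⊤)
    {A B : Matrix (Fin n) (Fin n) ℝ} (hA : A ∈ MatPos n) (hAB : A.det = B.det) : Ψ A = Ψ B := by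
  rcases le_or_gt n 1 with hn | hn
  · have := Fin.subsingleton_iff_le_one.2 hn
    rw [eq_of_det_eq_of_subsingleton hAB]
  obtain ⟨x, ν, hν, hspan⟩ := hbdry hn
  have hindep : LinearIndependent ℝ fun i => (ν i).ofLp :=
    (linearIndependent_of_top_le_span_of_card_eq_finrank hspan.ge (by simp)).map'
      (WithLp.linearEquiv 2 ℝ (Fin n → ℝ)).toLinearMap (LinearEquiv.ker _)
  refine eq_of_det_eq_of_shear_invariant hindep (ne_of_gt hA) (fun i M v hM hv => ?_) rfl hAB.symm
  have hinner : ⟪ν i, WithLp.toLp 2 v⟫_ℝ = 0 := by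
    rwa [EuclideanSpace.inner_eq_star_dotProduct]
  have hMdet : 0 < (matrixCLM n M).det := by
    rw [det_matrixCLM, hM]
    exact hA
  have hshear := hst.apply_mul_shear_of_isC1OutwardNormal hΩ
    (continuousOn_comp_matrixCLM_symm hΨ) (hν i) hinner hMdet
  rw [← matrixCLM_vecMulVec, ← map_one (matrixCLM n), ← map_add, ← map_mul] at hshear
  simpa only [Function.comp_apply, StarAlgEquiv.symm_apply_apply] using hshear

theorem det_diagonal_update_one {ι R : Type*} [Fintype ι] [DecidableEq ι] [CommRing R] (i : ι)
    (t : R) : (Matrix.diagonal (Function.update (1 : ι → R) i t)).det = t := by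
  rw [Matrix.det_diagonal, Finset.prod_update_of_mem (Finset.mem_univ i)]
  simp

theorem exists_convexOn_of_isStable (hst : IsStable Ω (Ψ ∘ (matrixCLM n).symm)) (hΩ : IsOpen Ω)
    (hne : Ω.Nonempty) (hΨ : ContinuousOn Ψ (MatPos n))
    (hbdry : 1 < n → ∃ x ν : Fin n → E n,
      (∀ i, IsC1OutwardNormal Ω (x i) (ν i)) ∧ Submodule.span ℝ (range ν) = ⊤) :
    ∃ h : ℝ → ℝ, ConvexOn ℝ (Ioi 0) h ∧ ∀ A ∈ MatPos n, Ψ A = h A.det := by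
  cases n with
  | zero =>
    exact ⟨fun _ => Ψ 1, convexOn_const _ (convex_Ioi 0), fun A _ => by rw [Subsingleton.elim A 1]⟩
  | succ n =>
    let D (t : ℝ) : Matrix (Fin (n + 1)) (Fin (n + 1)) ℝ := .diagonal (Function.update 1 0 t)
    have hD (t : ℝ) : (D t).det = t := det_diagonal_update_one 0 t
    have hΨD (A) (hA : A ∈ MatPos (n + 1)) : Ψ A = Ψ (D A.det) :=
      eq_of_det_eq_of_isStable hst hΩ hΨ hbdry hA (hD _).symm
    have hDcont : Continuous D := (continuous_const.update 0 continuous_id).matrix_diagonal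
    refine ⟨fun t => Ψ (D t), hst.convexOn hΩ hne (hΨ.comp hDcont.continuousOn ?_) ?_, hΨD⟩
    · exact fun t ht => ht.trans_eq (hD t).symm
    · intro A hA
      rw [Function.comp_apply, hΨD _ (matrixCLM_symm_mem_matPos hA), det_matrixCLM_symm]

theorem theorem4p2_general (hopen : IsOpen Ω) (hne : Ω.Nonempty) (hfin : volume Ω ≠ ⊤)
    (hbdry : 1 < n → ∃ x ν : Fin n → E n,
      (∀ i, IsC1OutwardNormal Ω (x i) (ν i)) ∧ Submodule.span ℝ (range ν) = ⊤)
    (hΨ : ContinuousOn Ψ (MatPos n)) :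
    (∀ M ∈ MatPos n, ∀ y ∈ admissible Ω M,
      ((Ψ M : ℝ) : EReal) ≤ extAverage Ω fun x => Ψ (grad y x)) ↔
    ∃ h : ℝ → ℝ, ConvexOn ℝ (Ioi 0) h ∧ ∀ A ∈ MatPos n, Ψ A = h A.det := by
  constructor
  · intro hmin
    have hst := isStable_of_coe_le_extAverage (hopen.measure_pos volume hne).ne' hfin hΨ hmin
    exact exists_convexOn_of_isStable hst hopen hne hΨ hbdry
  · rintro ⟨h, hh, hΨh⟩ M hM y hy
    rw [hΨh M hM]
    exact (coe_le_extAverage_of_convexOn hopen hne hfin hh hM hy).trans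
      (extAverage_mono hopen.measurableSet fun x hx => (hΨh _ (hy.det_pos x hx)).ge)

end Rigidity

end BoundarySliding

end

theorem theorem4p2 (n : ℕ) (hn : 1 ≤ n)
    (Ω : Set (BoundarySliding.E n)) (hopen : IsOpen Ω) (hconn : IsConnected Ω)
    (hbdd : Bornology.IsBounded Ω)
    (hbdry : 1 < n → ∃ x ν : Fin n → BoundarySliding.E n,
      (∀ i, BoundarySliding.IsC1OutwardNormal Ω (x i) (ν i)) ∧
      Submodule.span ℝ (Set.range ν) = ⊤)
    (Ψ : Matrix (Fin n) (Fin n) ℝ → ℝ) (hΨ : ContinuousOn Ψ (BoundarySliding.MatPos n)) :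
    (∀ M ∈ BoundarySliding.MatPos n, ∀ y ∈ BoundarySliding.admissible Ω M,
      ((Ψ M : ℝ) : EReal) ≤
        BoundarySliding.extAverage Ω (fun x => Ψ (BoundarySliding.grad y x))) ↔
    ∃ h : ℝ → ℝ, ConvexOn ℝ (Set.Ioi 0) h ∧
      ∀ A ∈ BoundarySliding.MatPos n, Ψ A = h A.det :=
  BoundarySliding.theorem4p2_general hopen hconn.nonempty hbdd.measure_lt_top.ne hbdry hΨ
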